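/- Conventions. Manifolds are smooth ($C^\infty$), Hausdorff, paracompact and finite-dimensional; vector bundles are smooth, real and of finite rank. For a simplicial manifold $X$ (a simplicial object of the category of smooth manifolds) let $d_i\colon X_n\to X_{n-1}$ be the face maps. An *$n,k$-horn* in $X$ is a simplicial map $\Lambda^n_k\to X$, where $\Lambda^n_k\subset\Delta^n$ is the simplicial set of all order-preserving maps $\theta\colon[m]\to[n]$ with $\mathrm{im}(\theta)\not\supset[n]\smallsetminus\{k\}$. A family $(x_s)_{s\in S}$ of $n,k$-horns indexed by a manifold $S$ is *smooth* if $s\mapsto x_s(\theta)$ is smooth for every simplex $\theta$ of $\Lambda^n_k$. The simplicial manifold $X$ is a *Lie $\infty$-groupoid* if for all $n\ge k\ge 0$ the set $\Lambda^n_k(X)$ of $n,k$-horns carries a manifold structure for which the smooth maps from manifolds $S$ are exactly the smooth families, and the restriction map $X_n\to\Lambda^n_k(X)$ is a surjective submersion. A *simplicial vector bundle* $V\to G$ is a simplicial object of the category of all smooth vector bundles (morphisms are smooth fiberwise linear maps covering smooth maps of the bases), where $G$ is the simplicial manifold of the bases. It is a *vector fibration* if $G$ is a Lie $\infty$-groupoid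 and $V\to G$ is a Kan fibration of simplicial sets, that is, has the right lifting property with respect to $\Lambda^n_k\subset\Delta^n$ for all $n\ge k\ge 0$. **Lemma.** Let $V\to G$ be a vector fibration. For $n\ge k\ge 0$ let $$K_{n,k}=\ker\bigl(V_n\to G_n\times_{\Lambda^n_k(G)}\Lambda^n_k(V)\bigr)$$ be the family of linear subspaces of the fibers of $V_n$ consisting of those vectors whose restriction to $\Lambda^n_k$ is zero, and for $n\ge 1$ let $$E_n=\bigcap_{j=0}^n\ker(d_j\colon V_n\to V_{n-1})\subset K_{n,k}.$$ Let $n\ge 1$ and $0\le k<l\le n+1$, and suppose that there is a smooth vector subbundle $C_{n+1}\subset V_{n+1}$ over $G_{n+1}$ such that $$V_{n+1}=C_{n+1}\oplus K_{n+1,k}=C_{n+1}\oplus K_{n+1,l}.$$ Then $d_k\colon G_n\to G_{n-1}$ is a submersion, and for each $g\in G_{n-1}$, with $Z=d_k^{-1}(g)$ regarded as an embedded submanifold of $G_n$, the restriction of $K_{n,k}$ to $Z$ admits a smooth vector bundle trivialization that carries $E_n$ into itself: there are a finite-dimensional vector space $F$, a linear subspace $F'\subset F$ and a smooth vector bundle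 isomorphism $Z\times F\cong K_{n,k}|_Z$ over $Z$ under which $Z\times F'$ corresponds to $E_n|_Z$. -/

import Mathlib

open CategoryTheory Simplicial Opposite Bundle Manifold
open scoped ContDiff

universe u

/-- A smooth manifold: of class `C^∞`, finite-dimensional, without boundary, Hausdorff and
paracompact. -/
structure Mfd : Type (u + 1) where
  carrier : Type u
  /-- the model space -/
  E : Type
  [normedE : NormedAddCommGroup E]
  [spaceE : NormedSpace ℝ E]
  [finiteE : FiniteDimensional ℝ E]
  [topology : TopologicalSpace carrier]
  [charted : ChartedSpace E carrier]
  [manifold : IsManifold 𝓘(ℝ, E) ∞ carrier]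
  [t2 : T2Space carrier]
  [paracompact : ParacompactSpace carrier]

namespace Mfd

instance : CoeSort Mfd.{u} (Type u) := ⟨Mfd.carrier⟩

attribute [instance] normedE spaceE finiteE topology charted manifold t2 paracompact

/-- Smoothness of a map between manifolds. -/
def IsSmooth {M N : Mfd.{u}} (f : M → N) : Prop := ContMDiff 𝓘(ℝ, M.E) 𝓘(ℝ, N.E) ∞ f

/-- Smooth maps. -/
@[ext]
structure Hom (M N : Mfd.{u}) where
  toFun : M → N
  smooth : IsSmooth toFun

/-- The category of smooth manifolds and smooth maps. -/
instance : Category Mfd.{u} where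
  Hom := Hom
  id M := ⟨id, contMDiff_id⟩
  comp f g := ⟨g.toFun ∘ f.toFun, ContMDiff.comp g.smooth f.smooth⟩

/-- The underlying set functor. -/
def forget : Mfd.{u} ⥤ Type u where
  obj M := M
  map f := ↾ (Hom.toFun f)

/-- A smooth submersion. -/
def IsSubmersion {M N : Mfd.{u}} (f : M → N) : Prop :=
  Manifold.IsSubmersion 𝓘(ℝ, M.E) 𝓘(ℝ, N.E) ∞ f

/-- A smooth embedding (an immersion that is a homeomorphism onto its image). -/
def IsEmbedding {M N : Mfd.{u}} (f : M → N) : Prop :=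
  Manifold.IsSmoothEmbedding 𝓘(ℝ, M.E) 𝓘(ℝ, N.E) ∞ f

end Mfd

/-- The simplicial set underlying a simplicial manifold. -/
def simplicialSetOf (X : SimplicialObject Mfd.{u}) : SSet.{u} :=
  ((SimplicialObject.whiskering _ _).obj Mfd.forget).obj X

/-- For a simplicial set `A` and a simplicial manifold `X`, a family `x` of simplicial maps `A ⟶ X`
parametrized by a manifold `S` is smooth if, for every simplex `a` of `A`, so is `s ↦ x(s) a`.
These families are the `S`-points of the sheaf `A(X)`. -/
def IsSmoothFamily {A : SSet.{u}} {X : SimplicialObject Mfd.{u}} {S : Mfd.{u}}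
    (x : S → (A ⟶ simplicialSetOf X)) : Prop :=
  ∀ (m : ℕ) (a : A _⦋m⦌), Mfd.IsSmooth (M := S) (N := X _⦋m⦌) fun s ↦ (x s).app (op ⦋m⦌) a

/-- The manifold `M` represents the sheaf `A(X)` through the bijection `e`. -/
def Represents {A : SSet.{u}} {X : SimplicialObject Mfd.{u}} (M : Mfd.{u})
    (e : M ≃ (A ⟶ simplicialSetOf X)) : Prop :=
  ∀ (S : Mfd.{u}) (f : S → M), Mfd.IsSmooth f ↔ IsSmoothFamily fun s ↦ e (f s)

/-- The horn `x | Λ[n, k]` of an `n`-simplex `x`. -/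
def restrictToHorn (X : SSet.{u}) (n : ℕ) (k : Fin (n + 1)) (x : X _⦋n⦌) :
    (Λ[n, k] : SSet.{u}) ⟶ X :=
  Λ[n, k].ι ≫ SSet.yonedaEquiv.symm x

/-- A Lie `∞`-groupoid: for all `n ≥ k ≥ 0` the sheaf of `n,k`-horns is representable and the
restriction map from `n`-simplices to `n,k`-horns is a surjective submersion. -/
def IsLieInfinityGroupoid (X : SimplicialObject Mfd.{u}) : Prop :=
  ∀ (n : ℕ) (k : Fin (n + 1)),
    ∃ (M : Mfd.{u}) (e : M ≃ ((Λ[n, k] : SSet.{u}) ⟶ simplicialSetOf X)),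
      Represents M e ∧
      Function.Surjective (restrictToHorn (simplicialSetOf X) n k) ∧
      Mfd.IsSubmersion (M := X _⦋n⦌) (N := M)
        fun x ↦ e.symm (restrictToHorn (simplicialSetOf X) n k x)

/-- A smooth real vector bundle of finite rank over a smooth manifold. -/
structure VB : Type (u + 1) where
  base : Mfd.{u}
  /-- the model fiber -/
  F : Type
  fiber : base → Type u
  [normedF : NormedAddCommGroup F]
  [spaceF : NormedSpace ℝ F]
  [finiteF : FiniteDimensional ℝ F]
  [addCommGroup : ∀ x, AddCommGroup (fiber x)]
  [module : ∀ x, Module ℝ (fiber x)]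
  [fiberTopology : ∀ x, TopologicalSpace (fiber x)]
  [totalTopology : TopologicalSpace (TotalSpace F fiber)]
  [fiberBundle : FiberBundle F fiber]
  [vectorBundle : VectorBundle ℝ F fiber]
  [smoothBundle : ContMDiffVectorBundle ∞ F fiber 𝓘(ℝ, base.E)]

namespace VB

attribute [instance] normedF spaceF finiteF addCommGroup module fiberTopology totalTopology
  fiberBundle vectorBundle smoothBundle

/-- The total space of a vector bundle. -/
abbrev Total (V : VB.{u}) : Type u := TotalSpace V.F V.fiber

/-- The model with corners of the total space. -/
noncomputable abbrev model (V : VB.{u}) := 𝓘(ℝ, V.base.E).prod 𝓘(ℝ, V.F)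

/-- Morphisms of smooth vector bundles: fiberwise linear smooth maps of the total spaces, covering
a smooth map of the bases. -/
@[ext]
structure Hom (V W : VB.{u}) where
  base : V.base ⟶ W.base
  fiberMap : ∀ x, V.fiber x →ₗ[ℝ] W.fiber (Mfd.Hom.toFun base x)
  smooth : ContMDiff V.model W.model ∞
    fun v : V.Total ↦ (⟨Mfd.Hom.toFun base v.proj, fiberMap v.proj v.snd⟩ : W.Total)

/-- The category of all smooth vector bundles. -/
instance : Category VB.{u} where
  Hom := Hom
  id V := ⟨𝟙 V.base, fun _ ↦ LinearMap.id, contMDiff_id⟩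
  comp f g := ⟨f.base ≫ g.base, fun x ↦ (g.fiberMap _).comp (f.fiberMap x),
    ContMDiff.comp g.smooth f.smooth⟩

/-- The base functor. -/
def baseFunctor : VB.{u} ⥤ Mfd.{u} where
  obj V := V.base
  map f := Hom.base f

/-- The functor sending a vector bundle to the set underlying its total space. -/
def totalFunctor : VB.{u} ⥤ Type u where
  obj V := V.Total
  map f := ↾ fun v ↦ ⟨Mfd.Hom.toFun (Hom.base f) v.proj, Hom.fiberMap f v.proj v.snd⟩

/-- The bundle projection. -/
def projection : totalFunctor.{u} ⟶ baseFunctor ⋙ Mfd.forget where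
  app _ := ↾ fun v ↦ v.proj

/-- A family `C` of linear subspaces of the fibers of `V` is a smooth vector subbundle if near every
point it is spanned by finitely many smooth sections of `V` that are linearly independent at every
point. -/
def IsSubbundle (V : VB.{u}) (C : ∀ x, Submodule ℝ (V.fiber x)) : Prop :=
  ∀ x₀ : V.base, ∃ U : Set V.base, IsOpen U ∧ x₀ ∈ U ∧
    ∃ (r : ℕ) (s : Fin r → ∀ x, V.fiber x),
      (∀ i, ContMDiffOn 𝓘(ℝ, V.base.E) V.model ∞ (fun x ↦ (⟨x, s i x⟩ : V.Total)) U) ∧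
      ∀ x ∈ U, LinearIndependent ℝ (fun i ↦ s i x) ∧
        Submodule.span ℝ (Set.range fun i ↦ s i x) = C x

/-- Let `K` be a family of linear subspaces of the fibers of `V` and let `ι : Z → V.base` be a
smooth map. A smooth vector bundle trivialization of the pullback of `K` along `ι`: a family of
linear isomorphisms of a fixed finite-dimensional vector space with the spaces `K (ι z)`, smooth in
both directions. -/
structure Trivialization (V : VB.{u}) (K : ∀ x, Submodule ℝ (V.fiber x)) {Z : Mfd.{u}}
    (ι : Z → V.base) where
  rank : ℕ
  equiv : ∀ z, EuclideanSpace ℝ (Fin rank) ≃ₗ[ℝ] K (ι z)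
  /-- the map from the trivial bundle over `Z` is smooth -/
  smooth : ContMDiff (𝓘(ℝ, Z.E).prod (𝓡 rank)) V.model ∞
    fun p : Z × EuclideanSpace ℝ (Fin rank) ↦ (⟨ι p.1, equiv p.1 p.2⟩ : V.Total)
  /-- its inverse sends smooth families of elements of `K` along `ι` to smooth families -/
  smooth_symm : ∀ (S : Mfd.{u}) (f : S → Z) (v : ∀ s, K (ι (f s))), Mfd.IsSmooth f →
    ContMDiff 𝓘(ℝ, S.E) V.model ∞ (fun s ↦ (⟨ι (f s), v s⟩ : V.Total)) →
    ContMDiff 𝓘(ℝ, S.E) (𝓡 rank) ∞ fun s ↦ (equiv (f s)).symm (v s)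

/-- The trivialization of `K` along `ι` carries the subfamily `L ≤ K` to a constant family of
subspaces of the model fiber, that is, it restricts to a trivialization of `L` along `ι`. -/
def Trivialization.Preserves {V : VB.{u}} {K : ∀ x, Submodule ℝ (V.fiber x)} {Z : Mfd.{u}}
    {ι : Z → V.base} (τ : V.Trivialization K ι) (L : ∀ x, Submodule ℝ (V.fiber x)) : Prop :=
  ∃ L₀ : Submodule ℝ (EuclideanSpace ℝ (Fin τ.rank)),
    ∀ z w, (τ.equiv z w : V.fiber (ι z)) ∈ L (ι z) ↔ w ∈ L₀

end VB

/-- A simplicial vector bundle is a simplicial object of `VB`. -/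
abbrev SimplicialVB := SimplicialObject VB.{u}

namespace SimplicialVB

/-- The base `G` of a simplicial vector bundle `V → G`. -/
def baseManifold (V : SimplicialVB.{u}) : SimplicialObject Mfd.{u} :=
  ((SimplicialObject.whiskering _ _).obj VB.baseFunctor).obj V

/-- The simplicial set formed by the total spaces. -/
def total (V : SimplicialVB.{u}) : SSet.{u} :=
  ((SimplicialObject.whiskering _ _).obj VB.totalFunctor).obj V

/-- The projection `p : V → G`, as a map of simplicial sets. -/
def projection (V : SimplicialVB.{u}) : V.total ⟶ simplicialSetOf V.baseManifold :=
  Functor.whiskerLeft V VB.projection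

/-- A vector fibration (higher vector bundle): the base is a Lie `∞`-groupoid and the projection is
a Kan fibration, that is, has the right lifting property with respect to the inclusions
`Λ[n, k] ⟶ Δ[n]` for all `n ≥ k ≥ 0`. -/
structure IsVectorFibration (V : SimplicialVB.{u}) : Prop where
  base : IsLieInfinityGroupoid V.baseManifold
  kan : ∀ (n : ℕ) (k : Fin (n + 1)), HasLiftingProperty (SSet.horn.{u} n k).ι V.projection

/-- The kernel, at the point `g : G_n`, of the linear map `V_θ : V_n → V_m`. -/
def ker (V : SimplicialVB.{u}) {n m : ℕ} (θ : ⦋m⦌ ⟶ ⦋n⦌) (g : (V _⦋n⦌).base) :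
    Submodule ℝ ((V _⦋n⦌).fiber g) :=
  LinearMap.ker (VB.Hom.fiberMap (V.map θ.op) g)

/-- `E_{n+1}`, the intersection of the kernels of all the face maps `d_j : V_{n+1} → V_n`. -/
def faceKernel (V : SimplicialVB.{u}) (n : ℕ) (g : (V _⦋n + 1⦌).base) :
    Submodule ℝ ((V _⦋n + 1⦌).fiber g) :=
  ⨅ j : Fin (n + 2), V.ker (SimplexCategory.δ j) g

/-- `K_{n,k}`, the kernel of the map from `V_n` to the bundle of `n,k`-horns of `V` over `G_n`. The
linear structure on the fibers of the latter is simplexwise, so that a vector `v` lies in the kernel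
when every simplex `θ : ⦋m⦌ ⟶ ⦋n⦌` of `Λ[n, k]` has `V_θ v = 0`. -/
def hornKernel (V : SimplicialVB.{u}) (n : ℕ) (k : Fin (n + 1)) (g : (V _⦋n⦌).base) :
    Submodule ℝ ((V _⦋n⦌).fiber g) :=
  ⨅ (m : ℕ) (θ : ⦋m⦌ ⟶ ⦋n⦌)
    (_ : SSet.stdSimplex.objEquiv.symm θ ∈ (SSet.horn.{u} n k).obj (op ⦋m⦌)), V.ker θ g

/-- The face map `d_k : G_{n+1} → G_n`. -/
def face (V : SimplicialVB.{u}) (n : ℕ) (k : Fin (n + 2)) : (V _⦋n + 1⦌).base → (V _⦋n⦌).base :=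
  Mfd.Hom.toFun (VB.Hom.base (V.δ k))

end SimplicialVB

/-! Indices are those of the English statement. The trivialization is a parallel transport through
degenerate simplices. For `z` in `Z` there is a degeneracy `w = s_j z` with `d_b w = z` and `d_a w =
s_{j'} g`, where `{a, b} = {k, l}`; the second face does not depend on `z`. Let `P` be the space of
vectors of `C` over `w` whose faces other than the `a`-th and `b`-th vanish. Then `d_b` maps `P`
isomorphically onto `K_{n,k}` at `z`: it is injective because `C` meets `K_{n+1,a}` in zero, and
surjective because a Kan filler of the horn with a given vector on face `b` and zeros elsewhere can
be moved into `C` by subtracting an element of `K_{n+1,a}`. By symmetry, using `K_{n+1,b}`, `d_a`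
maps `P` isomorphically onto a horn kernel at the fixed simplex `s_{j'} g`.

The resulting isomorphisms are smooth both ways, since a vector of `C` depends smoothly on its faces
other than the `a`-th, or other than the `b`-th (`contMDiff_of_d`). They respect `E_n`: inside a
horn kernel it is cut out by the one remaining face, and the remaining faces on the two sides are
the same codimension-two face of the vector of `P`.

That `d_k` is a submersion is a lifting argument. Germs of smooth maps into `G` form a simplicial
set whose evaluation at the origin has the lifting property for horns, because submersions have
local sections. Face inclusions are anodyne, so evaluation lifts against them too, which gives local
sections of `d_k`. -/

/-! ### Face inclusions of simplices are anodyne. -/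

section FaceAnodyne

open SSet MonoidalCategory CartesianMonoidalCategory

/-- The inclusion of a strong deformation retract is an anodyne extension. -/
theorem SSet.anodyneExtensions_of_deformationRetract {X Y : SSet.{u}} (f : X ⟶ Y) (p : Y ⟶ X)
    (hfp : ∀ m x, p.app m (f.app m x) = x) (H : Y ⊗ Δ[1] ⟶ Y) (a b : Fin 2)
    (h₀ : ∀ m (y : Y.obj m), H.app m (y, stdSimplex.const 1 a m) = y)
    (h₁ : ∀ m (x : X.obj m) (z : (Δ[1] : SSet.{u}).obj m), H.app m (f.app m x, z) = f.app m x)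
    (h₂ : ∀ m (y : Y.obj m) (z : (Δ[1] : SSet.{u}).obj m), z ∈ (SSet.horn.{u} 1 b).obj m →
      H.app m (y, z) = f.app m (p.app m y)) :
    anodyneExtensions f := by
  refine MorphismProperty.of_retract (P := anodyneExtensions) ?_
    (anodyneExtensions_unionProd_ι (Subcomplex.range f) (SSet.horn.{u} 1 b)
      (anodyneExtensions.horn_ι b))
  -- `f` is a retract of its pushout-product with a `1`-horn: the inclusion is at the end `a` of the
  -- cylinder, the retraction is `H`, which maps the subcomplex into the image of `f`.
  let c : Y ⟶ Y ⊗ Δ[1] := lift (𝟙 Y) (SSet.const (stdSimplex.obj₀Equiv.symm a))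
  have hc (m) (y : Y.obj m) : c.app m y = (y, stdSimplex.const 1 a m) := rfl
  refine
    { i := Arrow.homMk (Subcomplex.lift (f ≫ c) ?_) c ?_
      r := Arrow.homMk (Subcomplex.ι _ ≫ H ≫ p) H ?_
      retract := ?_ }
  · rintro m _ ⟨x, rfl⟩
    exact (Subcomplex.mem_unionProd_iff _ _ _).2 (Or.inr ⟨x, rfl⟩)
  · rfl
  · ext m ⟨⟨y, z⟩, hx⟩
    change f.app m (p.app m (H.app m (y, z))) = H.app m (y, z)
    obtain hz | ⟨x, hx⟩ := (Subcomplex.mem_unionProd_iff _ _ _).1 hx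
    · rw [h₂ _ _ _ hz, hfp]
    · obtain rfl : f.app m x = y := hx
      rw [h₁, hfp]
  · ext m x
    · change p.app m (H.app m (c.app m (f.app m x))) = x
      rw [hc, h₀, hfp]
    · exact h₀ m x

/-- The simplicial homotopy of endomorphisms of `Δ[n]` determined by order-preserving maps
`φ₀ ≤ φ₁`. -/
def SSet.stdSimplex.homotopyOfLE {n : ℕ} (φ₀ φ₁ : Fin (n + 1) →o Fin (n + 1)) (h : φ₀ ≤ φ₁) :
    (Δ[n] : SSet.{u}) ⊗ Δ[1] ⟶ Δ[n] where
  app m := ↾ fun x : (Δ[n] : SSet.{u}).obj m × (Δ[1] : SSet.{u}).obj m ↦ stdSimplex.objMk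
    ⟨fun j ↦ if stdSimplex.asOrderHom x.2 j = 0 then φ₀ (stdSimplex.asOrderHom x.1 j)
      else φ₁ (stdSimplex.asOrderHom x.1 j), fun i j hij ↦ by
        have h₁ := φ₀.monotone ((stdSimplex.asOrderHom x.1).monotone hij)
        have h₂ := φ₁.monotone ((stdSimplex.asOrderHom x.1).monotone hij)
        have h₃ := (stdSimplex.asOrderHom x.2).monotone hij
        have h₄ := h (stdSimplex.asOrderHom x.1 i)
        dsimp only
        split_ifs with hi hj hj
        · exact h₁
        · exact h₄.trans h₂
        · rw [hj] at h₃
          exact absurd (le_antisymm h₃ (Fin.zero_le _)) hi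
        · exact h₂⟩
  naturality _ _ _ := rfl

theorem SSet.stdSimplex.asOrderHom_injective {n : SimplexCategory} {m : SimplexCategoryᵒᵖ} :
    Function.Injective (stdSimplex.asOrderHom : (stdSimplex.{u}.obj n).obj m → _) :=
  fun _ _ h ↦ stdSimplex.objEquiv.injective (SimplexCategory.Hom.ext _ _ h)

/-- A vertex of a `1`-horn. -/
theorem SSet.asOrderHom_of_mem_horn_one {b : Fin 2} {m : SimplexCategoryᵒᵖ}
    {z : (Δ[1] : SSet.{u}).obj m} (hz : z ∈ (SSet.horn.{u} 1 b).obj m)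
    (j : Fin (m.unop.len + 1)) : stdSimplex.asOrderHom z j = b := by
  by_contra h
  refine hz (Set.eq_univ_iff_forall.2 fun i ↦ ?_)
  by_cases hi : i = b
  · exact Or.inr hi
  · exact Or.inl ⟨j, by omega⟩

/-- The face inclusions of a simplex are anodyne extensions. -/
theorem SSet.anodyneExtensions_δ {n : ℕ} (k : Fin (n + 2)) :
    anodyneExtensions (stdSimplex.{u}.δ k : Δ[n] ⟶ Δ[n + 1]) := by
  have key (i : Fin (n + 1)) (hσ : SimplexCategory.δ k ≫ SimplexCategory.σ i = 𝟙 _)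
      (φ₀ φ₁ : Fin (n + 2) →o Fin (n + 2)) (h : φ₀ ≤ φ₁) (a b : Fin 2)
      (ha : (if a = 0 then φ₀ else φ₁) = OrderHom.id)
      (hb : (if b = 0 then φ₀ else φ₁) =
        (SimplexCategory.σ i ≫ SimplexCategory.δ k).toOrderHom)
      (h₀ : φ₀ = OrderHom.id ∨ φ₀ = (SimplexCategory.σ i ≫ SimplexCategory.δ k).toOrderHom)
      (h₁ : φ₁ = OrderHom.id ∨ φ₁ = (SimplexCategory.σ i ≫ SimplexCategory.δ k).toOrderHom) :
      anodyneExtensions (stdSimplex.{u}.δ k : Δ[n] ⟶ Δ[n + 1]) := by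
    have hσ' (x) : (SimplexCategory.σ i).toOrderHom ((SimplexCategory.δ k).toOrderHom x) = x :=
      DFunLike.congr_fun (congr_arg SimplexCategory.Hom.toOrderHom hσ) x
    refine anodyneExtensions_of_deformationRetract _ (stdSimplex.σ i) (fun m x ↦ ?_)
      (stdSimplex.homotopyOfLE φ₀ φ₁ h) a b (fun m y ↦ ?_) (fun m x z ↦ ?_) (fun m y z hz ↦ ?_)
    · refine stdSimplex.asOrderHom_injective (OrderHom.ext _ _ (funext fun j ↦ ?_))
      exact hσ' _
    · refine stdSimplex.asOrderHom_injective (OrderHom.ext _ _ (funext fun j ↦ ?_))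
      change (if a = 0 then φ₀ _ else φ₁ _) = _
      rw [← apply_ite (fun φ : Fin (n + 2) →o Fin (n + 2) ↦ φ (stdSimplex.asOrderHom y j)), ha]
      rfl
    · refine stdSimplex.asOrderHom_injective (OrderHom.ext _ _ (funext fun j ↦ ?_))
      change (if stdSimplex.asOrderHom z j = 0 then
        φ₀ ((SimplexCategory.δ k).toOrderHom (stdSimplex.asOrderHom x j)) else φ₁ _) =
        (SimplexCategory.δ k).toOrderHom (stdSimplex.asOrderHom x j)
      have hfix (φ : Fin (n + 2) →o Fin (n + 2)) (hφ : φ = OrderHom.id ∨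
          φ = (SimplexCategory.σ i ≫ SimplexCategory.δ k).toOrderHom) (x) :
          φ ((SimplexCategory.δ k).toOrderHom x) = (SimplexCategory.δ k).toOrderHom x := by
        obtain rfl | rfl := hφ
        · rfl
        · exact congr_arg (SimplexCategory.δ k).toOrderHom (hσ' x)
      split_ifs
      · exact hfix _ h₀ _
      · exact hfix _ h₁ _
    · refine stdSimplex.asOrderHom_injective (OrderHom.ext _ _ (funext fun j ↦ ?_))
      change (if stdSimplex.asOrderHom z j = 0 then
        φ₀ (stdSimplex.asOrderHom y j) else φ₁ _) = _
      rw [asOrderHom_of_mem_horn_one hz,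
        ← apply_ite (fun φ : Fin (n + 2) →o Fin (n + 2) ↦ φ (stdSimplex.asOrderHom y j)), hb]
      rfl
  -- The composite of the retraction with the face lies below the identity for the last face and
  -- above it otherwise, so the direction of the homotopy depends on the case.
  induction k using Fin.lastCases with
  | last =>
    refine key (Fin.last n) SimplexCategory.δ_comp_σ_succ
      (SimplexCategory.σ (Fin.last n) ≫ SimplexCategory.δ (Fin.last _)).toOrderHom OrderHom.id
      (fun x ↦ ?_) 1 0 rfl rfl (Or.inr rfl) (Or.inl rfl)
    change Fin.succAbove (Fin.last _) (Fin.predAbove (Fin.last n) x) ≤ x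
    rw [Fin.succAbove_last]
    obtain hx | hx := lt_or_ge (Fin.last n).castSucc x
    · rw [Fin.predAbove_of_castSucc_lt _ _ hx]
      simp [Fin.le_def]
    · rw [Fin.predAbove_of_le_castSucc _ _ hx, Fin.castSucc_castPred]
  | cast i =>
    refine key i SimplexCategory.δ_comp_σ_self OrderHom.id
      (SimplexCategory.σ i ≫ SimplexCategory.δ i.castSucc).toOrderHom (fun x ↦ ?_) 0 1 rfl rfl
      (Or.inl rfl) (Or.inr rfl)
    change x ≤ Fin.succAbove i.castSucc (Fin.predAbove i x)
    obtain hx | hx := lt_or_ge i.castSucc x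
    · rw [Fin.predAbove_of_castSucc_lt _ _ hx, Fin.succAbove_of_le_castSucc, Fin.succ_pred]
      simp only [Fin.le_def, Fin.lt_def, Fin.val_castSucc, Fin.val_pred] at hx ⊢
      omega
    · rw [Fin.predAbove_of_le_castSucc _ _ hx]
      obtain hx' | rfl := hx.lt_or_eq
      · rw [Fin.succAbove_of_castSucc_lt _ _ (by simpa using hx'), Fin.castSucc_castPred]
      · rw [Fin.succAbove_of_le_castSucc _ _ (by simp)]
        simp [Fin.le_def]

end FaceAnodyne

/-! ### Submersions and smooth local sections. -/

section Submersions

open Filter Topology Set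

variable {E E' F : Type*} [NormedAddCommGroup E] [NormedSpace ℝ E] [FiniteDimensional ℝ E]
  [NormedAddCommGroup E'] [NormedSpace ℝ E'] [FiniteDimensional ℝ E']
  [NormedAddCommGroup F] [NormedSpace ℝ F] [FiniteDimensional ℝ F]
  {M N : Type*} [TopologicalSpace M] [ChartedSpace E M] [IsManifold 𝓘(ℝ, E) ∞ M]
  [TopologicalSpace N] [ChartedSpace E' N] [IsManifold 𝓘(ℝ, E') ∞ N]

omit [FiniteDimensional ℝ E] [FiniteDimensional ℝ E'] [FiniteDimensional ℝ F]
  [IsManifold 𝓘(ℝ, E) ∞ M] [IsManifold 𝓘(ℝ, E') ∞ N] in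
/-- A submersion has smooth local sections through every point. -/
theorem Manifold.IsSubmersionAtOfComplement.exists_local_section {f : M → N} {x : M}
    (hf : IsSubmersionAtOfComplement F 𝓘(ℝ, E) 𝓘(ℝ, E') ∞ f x) :
    ∃ σ : N → M, σ (f x) = x ∧
      ∀ᶠ y in 𝓝 (f x), ContMDiffAt 𝓘(ℝ, E') 𝓘(ℝ, E) ∞ σ y ∧ f (σ y) = y := by
  set φ := hf.domChart
  set ψ := hf.codChart
  have hxφ : x ∈ φ.source := hf.mem_domChart_source
  have hxψ : f x ∈ ψ.source := hf.mem_codChart_source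
  have hw (z) (hz : z ∈ φ.target) : ψ (f (φ.symm z)) = (hf.equiv z).1 := by
    have hz' : z ∈ (φ.extend 𝓘(ℝ, E)).target := by simpa using hz
    simpa using hf.writtenInCharts hz'
  -- In adapted charts `f` is a projection; a section is obtained by freezing the complementary
  -- coordinate at its value at `x`.
  let b : F := (hf.equiv (φ x)).2
  let s : N → E := fun y ↦ hf.equiv.symm (ψ y, b)
  have hs : s (f x) = φ x := by
    have : (ψ (f x), b) = hf.equiv (φ x) := by
      refine Prod.ext ?_ rfl
      rw [← hw _ (φ.map_source hxφ), φ.left_inv hxφ]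
    simp only [s, this, ContinuousLinearEquiv.symm_apply_apply]
  have hψ : ContMDiffOn 𝓘(ℝ, E') 𝓘(ℝ, E') ∞ ψ ψ.source :=
    contMDiffOn_of_mem_maximalAtlas hf.codChart_mem_maximalAtlas
  have hφ : ContMDiffOn 𝓘(ℝ, E) 𝓘(ℝ, E) ∞ φ.symm φ.target :=
    contMDiffOn_symm_of_mem_maximalAtlas hf.domChart_mem_maximalAtlas
  have hsd (y) (hy : y ∈ ψ.source) : ContMDiffAt 𝓘(ℝ, E') 𝓘(ℝ, E) ∞ s y := by
    have h₁ : ContMDiffAt 𝓘(ℝ, E') 𝓘(ℝ, E') ∞ ψ y := hψ.contMDiffAt (ψ.open_source.mem_nhds hy)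
    have h₂ : ContDiff ℝ ∞ fun z : E' ↦ hf.equiv.symm (z, b) := by fun_prop
    exact h₂.contMDiff.contMDiffAt.comp y h₁
  refine ⟨fun y ↦ φ.symm (s y), by simp only [hs, φ.left_inv hxφ], ?_⟩
  have h₁ : ∀ᶠ y in 𝓝 (f x), s y ∈ φ.target :=
    (hsd _ hxψ).continuousAt (by rw [hs]; exact φ.open_target.mem_nhds (φ.map_source hxφ))
  filter_upwards [h₁, ψ.open_source.mem_nhds hxψ] with y hy hyψ
  refine ⟨(hφ.contMDiffAt (φ.open_target.mem_nhds hy)).comp y (hsd y hyψ), ?_⟩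
  refine ψ.injOn (hf.source_subset_preimage_source (φ.map_target hy)) hyψ ?_
  rw [hw _ hy]
  simp [s]

/-- The normal form of a smooth map with surjective derivative. -/
theorem ContDiffOn.exists_openPartialHomeomorph_fst {g : E → E'} {U : Set E} (hU : IsOpen U)
    (hg : ContDiffOn ℝ ∞ g U) {a : E} (ha : a ∈ U)
    (hsurj : Function.Surjective (fderiv ℝ g a))
    (hF : Module.finrank ℝ E = Module.finrank ℝ E' + Module.finrank ℝ F) :
    ∃ (e : E ≃L[ℝ] E' × F) (h : OpenPartialHomeomorph E E), a ∈ h.source ∧ h.source ⊆ U ∧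
      ContDiffOn ℝ ∞ h h.source ∧ ContDiffOn ℝ ∞ h.symm h.target ∧
      ∀ y ∈ h.target, g (h.symm y) = (e y).1 := by
  set A := fderiv ℝ g a
  obtain ⟨p, hp⟩ := (LinearMap.ker A.toLinearMap).subtype.exists_leftInverse_of_injective
    (Submodule.ker_subtype _)
  have hker : Module.finrank ℝ (LinearMap.ker A.toLinearMap) = Module.finrank ℝ F := by
    have h₁ := A.toLinearMap.finrank_range_add_finrank_ker
    rw [LinearMap.range_eq_top.2 hsurj, finrank_top, hF] at h₁
    omega
  let q : E →ₗ[ℝ] F := (LinearEquiv.ofFinrankEq _ _ hker).toLinearMap.comp p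
  have hinj : Function.Injective (A.toLinearMap.prod q) := by
    rw [← LinearMap.ker_eq_bot, LinearMap.ker_eq_bot']
    intro y hy
    obtain ⟨h₁, h₂⟩ := Prod.ext_iff.1 hy
    have h₃ : p y = 0 := (LinearEquiv.ofFinrankEq _ _ hker).map_eq_zero_iff.1 h₂
    have h₄ := LinearMap.congr_fun hp ⟨y, h₁⟩
    exact congr_arg Subtype.val (h₄.symm.trans h₃)
  let e : E ≃L[ℝ] E' × F := (LinearMap.linearEquivOfInjective (A.toLinearMap.prod q) hinj
    (by rw [hF, Module.finrank_prod])).toContinuousLinearEquiv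
  have he (y) : e y = (A y, q y) := rfl
  -- The map `g` is completed to a local diffeomorphism by a projection onto the kernel of its
  -- derivative; `e.symm` normalizes the derivative at `a` to the identity.
  let h : E → E := fun y ↦ e.symm (g y, q.toContinuousLinearMap y)
  have hh : ContDiffOn ℝ ∞ h U :=
    e.symm.contDiff.comp_contDiffOn (hg.prodMk q.toContinuousLinearMap.contDiff.contDiffOn)
  have hh' (y) (hy : y ∈ U) : ContDiffAt ℝ ∞ h y := hh.contDiffAt (hU.mem_nhds hy)
  have hga : HasFDerivAt g A a :=
    ((hg.contDiffAt (hU.mem_nhds ha)).differentiableAt (by simp)).hasFDerivAt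
  have hda : HasFDerivAt h (ContinuousLinearEquiv.refl ℝ E : E →L[ℝ] E) a := by
    have h₁ := e.symm.hasFDerivAt.comp a (hga.prodMk q.toContinuousLinearMap.hasFDerivAt)
    convert! h₁ using 1
    ext y
    exact (e.symm_apply_apply y).symm
  let h₀ := (hh' a ha).toOpenPartialHomeomorph h hda (by simp)
  -- Shrinking to points with invertible derivative makes the inverse smooth on the whole target,
  -- not only at the image of `a`.
  have hinv : ∀ᶠ y in 𝓝 a, y ∈ U ∧ fderiv ℝ h y ∈ range ((↑) : (E ≃L[ℝ] E) → E →L[ℝ] E) := by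
    refine Filter.Eventually.and (hU.mem_nhds ha) ?_
    refine ((hh' a ha).continuousAt_fderiv (by simp)).eventually ?_
    rw [hda.fderiv]
    exact ContinuousLinearEquiv.nhds _
  obtain ⟨V, hVsub, hVo, haV⟩ := mem_nhds_iff.1 hinv
  refine ⟨e, h₀.restrOpen V hVo, ⟨(hh' a ha).mem_toOpenPartialHomeomorph_source hda (by simp), haV⟩,
    fun y hy ↦ (hVsub hy.2).1, fun y hy ↦ (hh' y (hVsub hy.2).1).contDiffWithinAt, ?_, ?_⟩
  · intro y hy
    have hy' := (h₀.restrOpen V hVo).map_target hy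
    obtain ⟨hyU, e', he'⟩ := hVsub hy'.2
    refine ((h₀.restrOpen V hVo).contDiffAt_symm (f₀' := e') hy ?_ (hh' _ hyU)).contDiffWithinAt
    rw [he']
    exact ((hh' _ hyU).differentiableAt (by simp)).hasFDerivAt
  · intro y hy
    have h₁ : h ((h₀.restrOpen V hVo).symm y) = y := (h₀.restrOpen V hVo).right_inv hy
    conv_rhs => rw [← h₁]
    simp [h]

/-- Composing a chart with an element of the structure groupoid yields a chart. -/
theorem StructureGroupoid.trans_mem_maximalAtlas {H M : Type*} [TopologicalSpace H]
    [TopologicalSpace M] [ChartedSpace H M] {G : StructureGroupoid H}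
    {φ : OpenPartialHomeomorph M H} (hφ : φ ∈ G.maximalAtlas M) {h : OpenPartialHomeomorph H H}
    (hh : h ∈ G) : φ.trans h ∈ G.maximalAtlas M := by
  refine mem_maximalAtlas_iff.2 fun e he ↦ ?_
  obtain ⟨h₃, h₄⟩ := mem_maximalAtlas_iff.1 hφ e he
  constructor
  · rw [OpenPartialHomeomorph.trans_symm_eq_symm_trans_symm, OpenPartialHomeomorph.trans_assoc]
    exact G.trans (G.symm hh) h₃
  · rw [← OpenPartialHomeomorph.trans_assoc]
    exact G.trans h₄ hh

/-- A smooth map with a smooth local section through `x` is a submersion at `x`. -/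
theorem Manifold.IsSubmersionAtOfComplement.of_local_section {f : M → N}
    (hf : ContMDiff 𝓘(ℝ, E) 𝓘(ℝ, E') ∞ f) {x : M} {σ : N → M} (hσx : σ (f x) = x)
    (hσ : ContMDiffAt 𝓘(ℝ, E') 𝓘(ℝ, E) ∞ σ (f x)) (hfσ : ∀ᶠ y in 𝓝 (f x), f (σ y) = y) :
    IsSubmersionAtOfComplement
      (EuclideanSpace ℝ (Fin (Module.finrank ℝ E - Module.finrank ℝ E'))) 𝓘(ℝ, E) 𝓘(ℝ, E') ∞ f x := by
  set φ := chartAt E x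
  set ψ := chartAt E' (f x)
  have hxφ : x ∈ φ.source := mem_chart_source E x
  have hxψ : f x ∈ ψ.source := mem_chart_source E' (f x)
  have hφ := IsManifold.chart_mem_maximalAtlas (I := 𝓘(ℝ, E)) (n := ∞) x
  have hψ := IsManifold.chart_mem_maximalAtlas (I := 𝓘(ℝ, E')) (n := ∞) (f x)
  have hφs : ContMDiffOn 𝓘(ℝ, E) 𝓘(ℝ, E) ∞ φ.symm φ.target :=
    contMDiffOn_symm_of_mem_maximalAtlas hφ
  have hψc : ContMDiffOn 𝓘(ℝ, E') 𝓘(ℝ, E') ∞ ψ ψ.source := contMDiffOn_of_mem_maximalAtlas hψ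
  let U : Set E := φ.target ∩ φ.symm ⁻¹' (f ⁻¹' ψ.source)
  have hU : IsOpen U := φ.isOpen_inter_preimage_symm (ψ.open_source.preimage hf.continuous)
  let g : E → E' := fun y ↦ ψ (f (φ.symm y))
  have hg : ContDiffOn ℝ ∞ g U := by
    rw [← contMDiffOn_iff_contDiffOn]
    exact hψc.comp (hf.comp_contMDiffOn (hφs.mono inter_subset_left)) fun y hy ↦ hy.2
  have ha : φ x ∈ U := ⟨φ.map_source hxφ, by
    simp only [mem_preimage, φ.left_inv hxφ, hxψ]⟩
  have hga : g (φ x) = ψ (f x) := by simp only [g, φ.left_inv hxφ]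
  -- By the chain rule the derivative of the section, read in charts, is a right inverse.
  have hsurj : Function.Surjective (fderiv ℝ g (φ x)) := by
    have hψx : ψ.symm (ψ (f x)) = f x := ψ.left_inv hxψ
    have hψs : ContMDiffAt 𝓘(ℝ, E') 𝓘(ℝ, E') ∞ ψ.symm (ψ (f x)) :=
      (contMDiffOn_symm_of_mem_maximalAtlas hψ).contMDiffAt
        (ψ.open_target.mem_nhds (ψ.map_source hxψ))
    have hσψ : ContMDiffAt 𝓘(ℝ, E') 𝓘(ℝ, E) ∞ (fun z ↦ σ (ψ.symm z)) (ψ (f x)) :=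
      ContMDiffAt.comp _ (by rwa [hψx]) hψs
    have hφc : ContMDiffAt 𝓘(ℝ, E) 𝓘(ℝ, E) ∞ φ (σ (ψ.symm (ψ (f x)))) := by
      rw [hψx, hσx]
      exact (contMDiffOn_of_mem_maximalAtlas hφ).contMDiffAt (φ.open_source.mem_nhds hxφ)
    have hs : ContDiffAt ℝ ∞ (fun z ↦ φ (σ (ψ.symm z))) (ψ (f x)) := by
      rw [← contMDiffAt_iff_contDiffAt]
      exact ContMDiffAt.comp (g := φ) _ hφc hσψ
    have hsx : φ (σ (ψ.symm (ψ (f x)))) = φ x := by rw [hψx, hσx]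
    have hid : (fun z ↦ g (φ (σ (ψ.symm z)))) =ᶠ[𝓝 (ψ (f x))] id := by
      have e₁ : ∀ᶠ z in 𝓝 (ψ (f x)), σ (ψ.symm z) ∈ φ.source := by
        refine hσψ.continuousAt ?_
        rw [hψx, hσx]
        exact φ.open_source.mem_nhds hxφ
      have e₂ : ∀ᶠ z in 𝓝 (ψ (f x)), f (σ (ψ.symm z)) = ψ.symm z := by
        refine hψs.continuousAt.eventually (p := fun y ↦ f (σ y) = y) ?_
        rwa [hψx]
      filter_upwards [e₁, e₂, ψ.open_target.mem_nhds (ψ.map_source hxψ)] with z h₁ h₂ h₃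
      simp only [g, φ.left_inv h₁, h₂, ψ.right_inv h₃, id]
    have hd : HasFDerivAt g (fderiv ℝ g (φ x)) (φ (σ (ψ.symm (ψ (f x))))) := by
      rw [hsx]
      exact ((hg.contDiffAt (hU.mem_nhds ha)).differentiableAt (by simp)).hasFDerivAt
    have hc := (HasFDerivAt.comp (ψ (f x)) hd (hs.differentiableAt (by simp)).hasFDerivAt).unique
      ((hasFDerivAt_id (𝕜 := ℝ) (ψ (f x))).congr_of_eventuallyEq (f₁ := g ∘ _) hid)
    exact fun v ↦ ⟨_, DFunLike.congr_fun hc v⟩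
  -- Surjectivity ensures that the truncated subtraction of dimensions is a true one.
  have hF : Module.finrank ℝ E = Module.finrank ℝ E' + Module.finrank ℝ
      (EuclideanSpace ℝ (Fin (Module.finrank ℝ E - Module.finrank ℝ E'))) := by
    have h₁ := LinearMap.finrank_range_le (fderiv ℝ g (φ x)).toLinearMap
    rw [LinearMap.range_eq_top.2 hsurj, finrank_top] at h₁
    rw [finrank_euclideanSpace_fin]
    omega
  obtain ⟨e, h, hah, hhU, h₁, h₂, h₃⟩ := hg.exists_openPartialHomeomorph_fst hU ha hsurj hF
  have hh : h ∈ contDiffGroupoid ∞ 𝓘(ℝ, E) := by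
    rw [contDiffGroupoid, mem_groupoid_of_pregroupoid]
    simpa [contDiffPregroupoid] using ⟨h₁, h₂⟩
  refine mk_of_continuousAt hf.continuous.continuousAt e (φ.trans h) ψ ⟨hxφ, hah⟩ hxψ
    (StructureGroupoid.trans_mem_maximalAtlas hφ hh) hψ fun y hy ↦ ?_
  have hy' : y ∈ h.target ∧ h.symm y ∈ φ.target := by simpa using hy
  simpa [g] using h₃ y hy'.1

omit [FiniteDimensional ℝ E'] [IsManifold 𝓘(ℝ, E') ∞ N] in
/-- A property that holds near the origin holds on the whole range of some smooth self-map which is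
the identity near the origin. -/
theorem exists_contDiff_eventuallyEq_id {P : E → Prop} (hP : ∀ᶠ s in 𝓝 0, P s) :
    ∃ ρ : E → E, ContDiff ℝ ∞ ρ ∧ ρ =ᶠ[𝓝 0] id ∧ ∀ s, P (ρ s) := by
  obtain ⟨r, hr, hP⟩ := Metric.eventually_nhds_iff_ball.1 hP
  let b : ContDiffBump (0 : E) := ⟨r / 4, r / 2, by positivity, by linarith⟩
  refine ⟨fun s ↦ b s • s, b.contDiff.smul contDiff_id, ?_, fun s ↦ hP _ ?_⟩
  · filter_upwards [b.eventuallyEq_one] with s hs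
    simp [hs]
  · rw [mem_ball_zero_iff, norm_smul, Real.norm_eq_abs, abs_of_nonneg b.nonneg]
    by_cases hs : ‖s‖ < r / 2
    · have : b s * ‖s‖ ≤ 1 * ‖s‖ := mul_le_mul_of_nonneg_right b.le_one (norm_nonneg s)
      linarith
    · rw [b.zero_of_le_dist (by simpa using not_lt.1 hs)]
      simpa using hr

end Submersions

/-! ### Smooth germs and the submersivity of the face maps. -/

section FaceSubmersion

open Filter Topology SSet

theorem simplicialSetOf.δ_comp_yonedaEquiv_symm (X : SimplicialObject Mfd.{u}) {n : ℕ}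
    (x : X _⦋n + 1⦌) (j : Fin (n + 2)) :
    stdSimplex.δ j ≫ (SSet.yonedaEquiv (X := simplicialSetOf X)).symm x =
      (SSet.yonedaEquiv (X := simplicialSetOf X)).symm (Mfd.Hom.toFun (X.δ j) x) :=
  stdSimplex.δ_comp_yonedaEquiv_symm (X := simplicialSetOf X) x j

variable (W : Type) [NormedAddCommGroup W] [NormedSpace ℝ W] [FiniteDimensional ℝ W]

/-- A finite-dimensional vector space as a manifold in an arbitrary universe. -/
noncomputable def Mfd.ofNormedSpace : Mfd.{u} :=
  { carrier := ULift.{u} W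
    E := W
    charted := (Homeomorph.ulift (X := W)).isOpenEmbedding.singletonChartedSpace
    manifold := (Homeomorph.ulift (X := W)).isOpenEmbedding.isManifold_singleton
    paracompact := (Homeomorph.ulift (X := W)).isClosedEmbedding.paracompactSpace }

/-- The identification of a vector space with the associated manifold. -/
def Mfd.ofNormedSpace.up (s : W) : Mfd.ofNormedSpace.{u} W := ULift.up.{u} s

/-- The identification of the manifold associated with a vector space with the vector space. -/
def Mfd.ofNormedSpace.down (s : Mfd.ofNormedSpace.{u} W) : W := ULift.down.{u} s

theorem Mfd.ofNormedSpace.contMDiff_up :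
    ContMDiff 𝓘(ℝ, W) 𝓘(ℝ, (Mfd.ofNormedSpace.{u} W).E) ∞ (Mfd.ofNormedSpace.up.{u} W) := by
  let := (Homeomorph.ulift.{u} (X := W)).isOpenEmbedding.singletonChartedSpace
  have h := contMDiffOn_isOpenEmbedding_symm (I := 𝓘(ℝ, W)) (n := ∞)
    (Homeomorph.ulift.{u} (X := W)).isOpenEmbedding
  intro s
  refine ContMDiffAt.congr_of_eventuallyEq (h.contMDiffAt (x := s) ?_) (.of_forall fun x ↦ ?_)
  · rw [(Homeomorph.ulift.{u} (X := W)).range_coe]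
    exact univ_mem
  · exact (((Homeomorph.ulift.{u} (X := W)).isOpenEmbedding.toOpenPartialHomeomorph _).left_inv
      (x := ULift.up x) trivial).symm

theorem Mfd.ofNormedSpace.contMDiff_down :
    ContMDiff 𝓘(ℝ, (Mfd.ofNormedSpace.{u} W).E) 𝓘(ℝ, W) ∞ (Mfd.ofNormedSpace.down.{u} W) :=
  contMDiff_isOpenEmbedding (Homeomorph.ulift.{u} (X := W)).isOpenEmbedding

/-- The simplicial set of germs at the origin of smooth maps from a vector space to a simplicial
manifold. -/
def smoothGerms (X : SimplicialObject Mfd.{u}) : SSet.{u} where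
  obj m := {g : Germ (𝓝 (0 : W)) (X.obj m) // ∃ f : W → X.obj m,
    ContMDiff 𝓘(ℝ, W) 𝓘(ℝ, (X.obj m).E) ∞ f ∧ g = f}
  map {m m'} φ := ↾ fun g ↦ ⟨g.1.map (Mfd.Hom.toFun (X.map φ)), by
    obtain ⟨_, f, hf, rfl⟩ := g
    exact ⟨_, ContMDiff.comp (Mfd.Hom.smooth (X.map φ)) hf, rfl⟩⟩
  map_id m := by
    ext ⟨_, f, hf, rfl⟩
    exact congr_arg (fun h ↦ Germ.ofFun (Mfd.Hom.toFun h ∘ f)) (X.map_id m)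
  map_comp φ ψ := by
    ext ⟨_, f, hf, rfl⟩
    exact congr_arg (fun h ↦ Germ.ofFun (Mfd.Hom.toFun h ∘ f)) (X.map_comp φ ψ)

/-- Evaluation of germs at the origin. -/
def smoothGerms.eval (X : SimplicialObject Mfd.{u}) : smoothGerms W X ⟶ simplicialSetOf X where
  app m := ↾ fun g ↦ g.1.value
  naturality m m' φ := by
    ext ⟨_, f, hf, rfl⟩
    rfl

variable {W}

/-- A smooth map as a simplex of the simplicial set of smooth germs. -/
def smoothGerms.mk {X : SimplicialObject Mfd.{u}} {m : SimplexCategoryᵒᵖ} (f : W → X.obj m)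
    (hf : ContMDiff 𝓘(ℝ, W) 𝓘(ℝ, (X.obj m).E) ∞ f) : (smoothGerms W X).obj m :=
  ⟨f, f, hf, rfl⟩

omit [FiniteDimensional ℝ W] in
theorem smoothGerms.exists_mk {X : SimplicialObject Mfd.{u}} {m : SimplexCategoryᵒᵖ}
    (g : (smoothGerms W X).obj m) : ∃ f hf, g = smoothGerms.mk f hf := by
  obtain ⟨_, f, hf, rfl⟩ := g
  exact ⟨f, hf, rfl⟩

omit [FiniteDimensional ℝ W] in
theorem smoothGerms.mk_eq_mk {X : SimplicialObject Mfd.{u}} {m : SimplexCategoryᵒᵖ}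
    {f f' : W → X.obj m} {hf hf'} :
    (smoothGerms.mk f hf = smoothGerms.mk f' hf') ↔ f =ᶠ[𝓝 0] f' :=
  Subtype.ext_iff.trans Germ.coe_eq

omit [FiniteDimensional ℝ W] in
theorem smoothGerms.δ_mk {X : SimplicialObject Mfd.{u}} {n : ℕ} (j : Fin (n + 2))
    (f : W → X _⦋n + 1⦌) (hf : ContMDiff 𝓘(ℝ, W) 𝓘(ℝ, (X _⦋n + 1⦌).E) ∞ f) :
    (smoothGerms W X).δ j (smoothGerms.mk f hf) =
      smoothGerms.mk (Mfd.Hom.toFun (X.δ j) ∘ f)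
        (ContMDiff.comp (Mfd.Hom.smooth (X.δ j)) hf) :=
  rfl

-- Compatibility is a finite set of equations between faces, so it holds for germs exactly when it
-- holds pointwise on a common neighborhood.
omit [FiniteDimensional ℝ W] in
theorem smoothGerms.isCompatible_iff {X : SimplicialObject Mfd.{u}} {n : ℕ} {i : Fin (n + 2)}
    {f : ∀ (j : Fin (n + 2)) (_ : j ≠ i), W → X _⦋n⦌}
    (hf : ∀ j hj, ContMDiff 𝓘(ℝ, W) 𝓘(ℝ, (X _⦋n⦌).E) ∞ (f j hj)) :
    horn.IsCompatible (fun j hj ↦ SSet.yonedaEquiv.symm (smoothGerms.mk (f j hj) (hf j hj))) ↔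
    ∀ᶠ s in 𝓝 (0 : W), horn.IsCompatible
      (fun j hj ↦ (SSet.yonedaEquiv (X := simplicialSetOf X)).symm (f j hj s)) := by
  obtain _ | n := n
  · simp
  · simp only [horn.isCompatible_iff, eventually_all]
    refine forall₅_congr fun j k hj hk hjk ↦ ?_
    rw [stdSimplex.δ_comp_yonedaEquiv_symm, stdSimplex.δ_comp_yonedaEquiv_symm,
      EmbeddingLike.apply_eq_iff_eq, smoothGerms.δ_mk, smoothGerms.δ_mk]
    refine smoothGerms.mk_eq_mk.trans (eventually_congr (.of_forall fun s ↦ ?_))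
    rw [simplicialSetOf.δ_comp_yonedaEquiv_symm, simplicialSetOf.δ_comp_yonedaEquiv_symm]
    exact (Equiv.apply_eq_iff_eq _).symm

/-- A germ of horns is a germ of a map to the manifold of horns; composing it with a local section
of the restriction map through the prescribed simplex yields a lift. -/
theorem smoothGerms.hasLiftingProperty {X : SimplicialObject Mfd.{u}}
    (hX : IsLieInfinityGroupoid X) (n : ℕ) (i : Fin (n + 2)) :
    HasLiftingProperty (SSet.horn.{u} (n + 1) i).ι (smoothGerms.eval W X) := by
  refine ⟨fun {t b} sq ↦ ?_⟩
  choose f hf hft using fun (j : Fin (n + 2)) (hj : j ≠ i) ↦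
    smoothGerms.exists_mk (SSet.yonedaEquiv (horn.ι i j hj ≫ t))
  replace hft (j) (hj : j ≠ i) : horn.ι i j hj ≫ t =
      SSet.yonedaEquiv.symm (smoothGerms.mk (f j hj) (hf j hj)) := by
    rw [← hft, Equiv.symm_apply_apply]
  have hcomp := horn.IsCompatible.of_hom t
  simp only [hft, smoothGerms.isCompatible_iff] at hcomp
  -- The faces are compatible only near the origin. Reparametrizing by `ρ` makes them compatible
  -- everywhere without changing germs.
  obtain ⟨ρ, hρ, hρid, hcomp⟩ := exists_contDiff_eventuallyEq_id hcomp
  obtain ⟨M, e, he, -, hsub⟩ := hX (n + 1) i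
  let x₀ : X _⦋n + 1⦌ := SSet.yonedaEquiv b
  have hface (x : X _⦋n + 1⦌) (j) (hj : j ≠ i) :
      horn.ι i j hj ≫ restrictToHorn (simplicialSetOf X) (n + 1) i x =
        SSet.yonedaEquiv.symm (Mfd.Hom.toFun (X.δ j) x) := by
    rw [← simplicialSetOf.δ_comp_yonedaEquiv_symm]
    exact horn.ι_ι_assoc i j hj _
  let v : W → M := fun s ↦ e.symm (hcomp s).desc
  have hv : ContMDiff 𝓘(ℝ, W) 𝓘(ℝ, M.E) ∞ v := by
    -- By representability, smoothness is tested simplexwise, and every simplex of the horn lies in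
    -- one of its faces.
    have h := (he (Mfd.ofNormedSpace.{u} W) fun s ↦ v (Mfd.ofNormedSpace.down W s)).2 fun m a ↦ by
      obtain ⟨j, hj, a', ha'⟩ : ∃ (j : Fin (n + 2)) (hj : j ≠ i) (a' : Δ[n] _⦋m⦌),
          (horn.ι i j hj).app (op ⦋m⦌) a' = a := by
        obtain ⟨j, hj, h⟩ := (mem_horn_iff_notMem_range _ _).1 a.2
        obtain ⟨θ, hθ⟩ := SimplexCategory.eq_comp_δ_of_not_surjective'
          (stdSimplex.objEquiv a.1) j fun x hx ↦ h ⟨x, hx⟩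
        refine ⟨j, hj, stdSimplex.objEquiv.symm θ, Subtype.ext ?_⟩
        exact stdSimplex.objEquiv.injective hθ.symm
      have h (s : W) : (hcomp s).desc.app (op ⦋m⦌) a =
          ((SSet.yonedaEquiv (X := simplicialSetOf X)).symm (f j hj (ρ s))).app (op ⦋m⦌) a' := by
        rw [← horn.IsCompatible.ι_desc (hcomp s) j hj, ← ha']
        rfl
      simp only [v, Equiv.apply_symm_apply, h]
      exact ContMDiff.comp (Mfd.Hom.smooth (X.map (SSet.stdSimplex.objEquiv a').op))
        ((hf j hj).comp (hρ.contMDiff.comp (Mfd.ofNormedSpace.contMDiff_down W)))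
    exact ContMDiff.comp (g := fun s ↦ v (Mfd.ofNormedSpace.down W s)) h
      (Mfd.ofNormedSpace.contMDiff_up W)
  have hv₀ : v 0 = e.symm (restrictToHorn (simplicialSetOf X) (n + 1) i x₀) := by
    refine congr_arg e.symm (horn.hom_ext' fun j hj ↦ ?_)
    rw [horn.IsCompatible.ι_desc, hface, hρid.eq_of_nhds, id]
    have h := congr_arg (horn.ι i j hj ≫ ·) sq.w
    simp only [horn.ι_ι_assoc] at h
    rw [← Category.assoc, hft] at h
    have h₁ := congr_arg SSet.yonedaEquiv h
    rw [SSet.yonedaEquiv_comp, Equiv.apply_symm_apply, stdSimplex.yonedaEquiv_δ_comp] at h₁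
    exact congr_arg _ h₁
  obtain ⟨F, _, _, hsub⟩ := hsub
  obtain ⟨σ, hσ₀, hσ⟩ := (hsub x₀).exists_local_section
  have hσv : ∀ᶠ s in 𝓝 (0 : W), ContMDiffAt 𝓘(ℝ, W) 𝓘(ℝ, (X _⦋n + 1⦌).E) ∞ (σ ∘ v) s ∧
      restrictToHorn (simplicialSetOf X) (n + 1) i (σ (v s)) = (hcomp s).desc := by
    rw [← hv₀] at hσ
    filter_upwards [hv.continuous.continuousAt.eventually hσ] with s hs
    exact ⟨hs.1.comp s hv.contMDiffAt, e.symm.injective hs.2⟩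
  obtain ⟨ρ', hρ', hρid', hσv⟩ := exists_contDiff_eventuallyEq_id hσv
  have hlift : ContMDiff 𝓘(ℝ, W) 𝓘(ℝ, (X _⦋n + 1⦌).E) ∞ fun s ↦ σ (v (ρ' s)) :=
    fun s ↦ (hσv s).1.comp s hρ'.contMDiff.contMDiffAt
  refine ⟨⟨⟨SSet.yonedaEquiv.symm (smoothGerms.mk _ hlift), horn.hom_ext' fun j hj ↦ ?_, ?_⟩⟩⟩
  · rw [hft, horn.ι_ι_assoc, stdSimplex.δ_comp_yonedaEquiv_symm, smoothGerms.δ_mk]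
    congr 1
    refine smoothGerms.mk_eq_mk.2 ?_
    filter_upwards [hρid, hρid'] with s h₁ h₂
    have h₃ := congr_arg (horn.ι i j hj ≫ ·) (hσv s).2
    simp only [hface, horn.IsCompatible.ι_desc] at h₃
    refine (SSet.yonedaEquiv.symm.injective h₃).trans ?_
    rw [h₂, id, h₁, id]
  · refine SSet.yonedaEquiv.injective ?_
    rw [SSet.yonedaEquiv_comp, Equiv.apply_symm_apply]
    change σ (v (ρ' 0)) = x₀
    rw [hρid'.eq_of_nhds, id, hv₀, hσ₀]

/-- The face maps of a Lie `∞`-groupoid are submersions. -/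
theorem IsLieInfinityGroupoid.isSubmersion_δ {X : SimplicialObject Mfd.{u}}
    (hX : IsLieInfinityGroupoid X) (n : ℕ) (k : Fin (n + 2)) :
    Mfd.IsSubmersion (Mfd.Hom.toFun (X.δ k)) := by
  refine ⟨EuclideanSpace ℝ (Fin (Module.finrank ℝ (X _⦋n + 1⦌).E - Module.finrank ℝ (X _⦋n⦌).E)),
    inferInstance, inferInstance, fun x ↦ ?_⟩
  set d : X _⦋n + 1⦌ → X _⦋n⦌ := Mfd.Hom.toFun (X.δ k)
  set φ := chartAt (X _⦋n⦌).E (d x)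
  have hx : d x ∈ φ.source := mem_chart_source _ _
  have hP : ∀ᶠ s in 𝓝 (0 : (X _⦋n⦌).E), φ (d x) + s ∈ φ.target := by
    -- The germ to be lifted is the inverse of a chart at `d x`, recentred at the origin.
    have h : ContinuousAt (fun s ↦ φ (d x) + s) (0 : (X _⦋n⦌).E) := by fun_prop
    refine h (φ.open_target.mem_nhds ?_)
    beta_reduce
    rw [add_zero]
    exact φ.map_source hx
  obtain ⟨ρ, hρ, hρid, hP⟩ := exists_contDiff_eventuallyEq_id hP
  let y : (X _⦋n⦌).E → X _⦋n⦌ := fun s ↦ φ.symm (φ (d x) + ρ s)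
  have hy : ContMDiff 𝓘(ℝ, (X _⦋n⦌).E) 𝓘(ℝ, (X _⦋n⦌).E) ∞ y := fun s ↦
    ((contMDiffOn_symm_of_mem_maximalAtlas (IsManifold.chart_mem_maximalAtlas (d x))).contMDiffAt
      (φ.open_target.mem_nhds (hP s))).comp s (contDiff_const.add hρ).contMDiff.contMDiffAt
  have hy₀ : y 0 = d x := by
    simp only [y, hρid.eq_of_nhds, id, add_zero, φ.left_inv hx]
  -- Generating horn inclusions have positive dimension, and anodyne maps inherit the lifting
  -- property from them.
  have hlift : HasLiftingProperty (stdSimplex.{u}.δ k) (smoothGerms.eval (X _⦋n⦌).E X) := by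
    refine anodyneExtensions_δ k _ fun _ _ i hi ↦ ?_
    simp only [modelCategoryQuillen.J, MorphismProperty.iSup_iff] at hi
    obtain ⟨m, ⟨j⟩⟩ := hi
    exact smoothGerms.hasLiftingProperty hX m j
  have sq : CommSq (SSet.yonedaEquiv.symm (smoothGerms.mk y hy)) (stdSimplex.{u}.δ k)
      (smoothGerms.eval (X _⦋n⦌).E X) ((SSet.yonedaEquiv (X := simplicialSetOf X)).symm x) := by
    refine ⟨?_⟩
    rw [simplicialSetOf.δ_comp_yonedaEquiv_symm]
    refine SSet.yonedaEquiv.injective ?_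
    rw [SSet.yonedaEquiv_comp, Equiv.apply_symm_apply]
    exact hy₀.trans
      ((SSet.yonedaEquiv (X := simplicialSetOf X)).apply_symm_apply (d x : X _⦋n⦌)).symm
  obtain ⟨F, hF, hFl⟩ := smoothGerms.exists_mk (SSet.yonedaEquiv sq.lift)
  have h₁ : d ∘ F =ᶠ[𝓝 0] y := by
    have h := congr_arg SSet.yonedaEquiv sq.fac_left
    rw [stdSimplex.yonedaEquiv_δ_comp, hFl, Equiv.apply_symm_apply, smoothGerms.δ_mk] at h
    exact smoothGerms.mk_eq_mk.1 h
  have h₂ : F 0 = x := by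
    have h := congr_arg SSet.yonedaEquiv sq.fac_right
    rw [SSet.yonedaEquiv_comp, hFl] at h
    exact h.trans (SSet.yonedaEquiv.apply_symm_apply _)
  have hφ : ContMDiffAt 𝓘(ℝ, (X _⦋n⦌).E) 𝓘(ℝ, (X _⦋n⦌).E) ∞ (fun z ↦ φ z - φ (d x)) (d x) :=
    ((contMDiffOn_of_mem_maximalAtlas (IsManifold.chart_mem_maximalAtlas (d x))).contMDiffAt
      (φ.open_source.mem_nhds hx)).sub contMDiffAt_const
  refine IsSubmersionAtOfComplement.of_local_section (Mfd.Hom.smooth (X.δ k))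
    (σ := fun z ↦ F (φ z - φ (d x))) ?_ (hF.contMDiffAt.comp _ hφ) ?_
  · change F (φ (d x) - φ (d x)) = x
    rw [sub_self, h₂]
  · have h₃ : ∀ᶠ z in 𝓝 (d x), d (F (φ z - φ (d x))) = y (φ z - φ (d x)) ∧
        ρ (φ z - φ (d x)) = φ z - φ (d x) := by
      refine hφ.continuousAt.eventually (p := fun s ↦ d (F s) = y s ∧ ρ s = s) ?_
      beta_reduce
      rw [sub_self]
      exact h₁.and hρid
    filter_upwards [h₃, φ.open_source.mem_nhds hx] with z h₄ h₅
    refine h₄.1.trans ?_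
    simp only [y, h₄.2, add_sub_cancel, φ.left_inv h₅]

end FaceSubmersion

/-! ### Smooth families of vectors in a subbundle. -/

section VectorBundleSmoothness

open Filter Topology

variable {ES HS S : Type*} [NormedAddCommGroup ES] [NormedSpace ℝ ES] [TopologicalSpace HS]
  {I : ModelWithCorners ℝ ES HS} [TopologicalSpace S] [ChartedSpace HS S]

/-- The solution of a linear system that depends smoothly on parameters depends smoothly on the
parameters where the linear map is injective. -/
theorem ContMDiffAt.exists_solution {E₁ E₂ : Type*} [NormedAddCommGroup E₁] [NormedSpace ℝ E₁]
    [FiniteDimensional ℝ E₁] [NormedAddCommGroup E₂] [NormedSpace ℝ E₂] [FiniteDimensional ℝ E₂]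
    {Ψ : S → E₁ →L[ℝ] E₂} {y : S → E₂} {s₀ : S} (hΨ : ContMDiffAt I 𝓘(ℝ, E₁ →L[ℝ] E₂) ∞ Ψ s₀)
    (hinj : Function.Injective (Ψ s₀)) (hy : ContMDiffAt I 𝓘(ℝ, E₂) ∞ y s₀) :
    ∃ τ : S → E₁, ContMDiffAt I 𝓘(ℝ, E₁) ∞ τ s₀ ∧ ∀ᶠ s in 𝓝 s₀, ∀ t, Ψ s t = y s → t = τ s := by
  obtain ⟨L, hL⟩ := (Ψ s₀).toLinearMap.exists_leftInverse_of_injective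
    (LinearMap.ker_eq_bot.2 hinj)
  -- A left inverse of `Ψ s₀` turns the system into a square one, equal to the identity at `s₀` and
  -- hence invertible nearby.
  let A : S → E₁ →L[ℝ] E₁ := fun s ↦ L.toContinuousLinearMap.comp (Ψ s)
  have hA : ContMDiffAt I 𝓘(ℝ, E₁ →L[ℝ] E₁) ∞ A s₀ := contMDiffAt_const.clm_comp hΨ
  have hA₀ : A s₀ = ((1 : (E₁ →L[ℝ] E₁)ˣ) : E₁ →L[ℝ] E₁) := by
    ext t
    exact LinearMap.congr_fun hL t
  have hinv : ContMDiffAt I 𝓘(ℝ, E₁ →L[ℝ] E₁) ∞ (fun s ↦ Ring.inverse (A s)) s₀ := by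
    have h : ContDiffAt ℝ ∞ Ring.inverse (A s₀) := by
      rw [hA₀]
      exact contDiffAt_ringInverse ℝ 1
    exact h.contMDiffAt.comp s₀ hA
  refine ⟨fun s ↦ Ring.inverse (A s) (L.toContinuousLinearMap (y s)),
    hinv.clm_apply (contMDiffAt_const.clm_apply hy), ?_⟩
  have hu : ∀ᶠ s in 𝓝 s₀, IsUnit (A s) :=
    hA.continuousAt.eventually (by rw [hA₀]; exact Units.nhds 1)
  filter_upwards [hu] with s hs t ht
  rw [← ht]
  exact (DFunLike.congr_fun (Ring.inverse_mul_cancel _ hs) t).symm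

variable {V W : VB.{u}}

theorem VB.finiteDimensional_fiber (V : VB.{u}) (x : V.base) :
    FiniteDimensional ℝ (V.fiber x) :=
  ((trivializationAt V.F V.fiber x).linearEquivAt ℝ x
    (FiberBundle.mem_baseSet_trivializationAt' x)).symm.finiteDimensional

/-- The map of total spaces induced by a morphism of vector bundles. -/
def VB.Hom.total (f : VB.Hom V W) (v : V.Total) : W.Total :=
  ⟨f.base.toFun v.proj, f.fiberMap v.proj v.snd⟩

theorem VB.Hom.contMDiff_total (f : VB.Hom V W) : ContMDiff V.model W.model ∞ f.total :=
  f.smooth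

/-- A linear parametrization of vectors in a fixed fiber is smooth. -/
theorem VB.contMDiff_mk_fiber {F₀ : Type*} [NormedAddCommGroup F₀] [NormedSpace ℝ F₀]
    [FiniteDimensional ℝ F₀] (x : V.base) (L : F₀ →ₗ[ℝ] V.fiber x) :
    ContMDiff 𝓘(ℝ, F₀) V.model ∞ (fun y ↦ (⟨x, L y⟩ : V.Total)) := by
  intro y
  refine contMDiffAt_totalSpace.2 ⟨contMDiffAt_const, ?_⟩
  let e := trivializationAt V.F V.fiber x
  have he : x ∈ e.baseSet := FiberBundle.mem_baseSet_trivializationAt' x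
  refine (((e.linearEquivAt ℝ x he).toLinearMap.comp L).toContinuousLinearMap.contDiff.contMDiff
    (x := y)).congr_of_eventuallyEq (.of_forall fun z ↦ ?_)
  rfl

/-- A linear map on a fixed fiber takes smooth families of vectors to smooth families. -/
theorem VB.contMDiff_of_mk_fiber {F₀ : Type*} [NormedAddCommGroup F₀] [NormedSpace ℝ F₀]
    (x : V.base) (L : V.fiber x →ₗ[ℝ] F₀) {y : S → V.fiber x}
    (hy : ContMDiff I V.model ∞ (fun s ↦ (⟨x, y s⟩ : V.Total))) :
    ContMDiff I 𝓘(ℝ, F₀) ∞ (fun s ↦ L (y s)) := by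
  intro s
  have h := (contMDiffAt_totalSpace.1 (hy s)).2
  let e := trivializationAt V.F V.fiber x
  have he : x ∈ e.baseSet := FiberBundle.mem_baseSet_trivializationAt' x
  let M := (L.comp (e.linearEquivAt ℝ x he).symm.toLinearMap).toContinuousLinearMap
  refine (M.contDiff.contMDiff.contMDiffAt.comp s h).congr_of_eventuallyEq
    (.of_forall fun z ↦ ?_)
  exact congr_arg L ((e.linearEquivAt ℝ x he).symm_apply_apply (y z)).symm

/-- A family of vectors in a subbundle is smooth if its images under finitely many bundle maps
that are jointly injective on the subbundle are smooth. -/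
theorem VB.IsSubbundle.contMDiff {C : ∀ x, Submodule ℝ (V.fiber x)} (hC : V.IsSubbundle C)
    {ι : Type*} [Fintype ι] (f : ι → VB.Hom V W)
    (hf : ∀ x, ∀ v ∈ C x, (∀ i, (f i).fiberMap x v = 0) → v = 0) {w : S → V.base}
    (hw : ContMDiff I 𝓘(ℝ, V.base.E) ∞ w) (c : ∀ s, V.fiber (w s)) (hcC : ∀ s, c s ∈ C (w s))
    (hfc : ∀ i, ContMDiff I W.model ∞ fun s ↦ (f i).total ⟨w s, c s⟩) :
    ContMDiff I V.model ∞ fun s ↦ (⟨w s, c s⟩ : V.Total) := by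
  classical
  intro s₀
  obtain ⟨U, hU, hx₀, r, σ, hσ, hspan⟩ := hC (w s₀)
  let e₀ := trivializationAt V.F V.fiber (w s₀)
  let e (i : ι) := trivializationAt W.F W.fiber ((f i).base.toFun (w s₀))
  have he₀ : ∀ᶠ s in 𝓝 s₀, w s ∈ e₀.baseSet :=
    hw.continuous.continuousAt (e₀.open_baseSet.mem_nhds
      (FiberBundle.mem_baseSet_trivializationAt' _))
  have he : ∀ᶠ s in 𝓝 s₀, ∀ i, (f i).base.toFun (w s) ∈ (e i).baseSet := by
    refine eventually_all.2 fun i ↦ ?_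
    exact (((f i).base.smooth.continuous.comp hw.continuous).continuousAt)
      ((e i).open_baseSet.mem_nhds (FiberBundle.mem_baseSet_trivializationAt' _))
  have hwU : ∀ᶠ s in 𝓝 s₀, w s ∈ U := hw.continuous.continuousAt (hU.mem_nhds hx₀)
  have hσw (j) : ContMDiffAt I V.model ∞ (fun s ↦ (⟨w s, σ j (w s)⟩ : V.Total)) s₀ :=
    ((hσ j).contMDiffAt (hU.mem_nhds hx₀)).comp s₀ hw.contMDiffAt
  have ha (i j) : ContMDiffAt I 𝓘(ℝ, W.F) ∞
      (fun s ↦ (e i ((f i).total ⟨w s, σ j (w s)⟩)).2) s₀ :=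
    (contMDiffAt_totalSpace.1 ((f i).contMDiff_total.contMDiffAt.comp s₀ (hσw j))).2
  -- `Ψ s` sends coefficients in a local frame of `C` to the trivialized images under the `f i`. It
  -- is injective at `s₀`, so the coefficients of `c` depend smoothly on those images.
  let Ψ : S → (Fin r → ℝ) →L[ℝ] (ι → W.F) := fun s ↦ ∑ j,
    (ContinuousLinearMap.proj j).smulRight fun i ↦ (e i ((f i).total ⟨w s, σ j (w s)⟩)).2
  have hΨ : ContMDiffAt I 𝓘(ℝ, (Fin r → ℝ) →L[ℝ] (ι → W.F)) ∞ Ψ s₀ := by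
    refine contMDiffAt_finsetSum fun j _ ↦ ?_
    exact (ContinuousLinearMap.smulRightL ℝ (Fin r → ℝ) (ι → W.F)
      (ContinuousLinearMap.proj j)).contDiff.contMDiff.contMDiffAt.comp s₀
        (contMDiffAt_pi_space.2 fun i ↦ ha i j)
  have hΨ_apply (s) (hs : ∀ i, (f i).base.toFun (w s) ∈ (e i).baseSet) (t : Fin r → ℝ) (i) :
      Ψ s t i = (e i ((f i).total ⟨w s, ∑ j, t j • σ j (w s)⟩)).2 := by
    have h (v : V.fiber (w s)) : (e i ((f i).total ⟨w s, v⟩)).2 =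
        ((e i).linearEquivAt ℝ _ (hs i)) ((f i).fiberMap (w s) v) := rfl
    simp only [Ψ, h, map_sum, map_smul, sum_apply, Finset.sum_apply,
      ContinuousLinearMap.smulRight_apply, ContinuousLinearMap.proj_apply, Pi.smul_apply]
  have hinj : Function.Injective (Ψ s₀) := by
    refine (injective_iff_map_eq_zero _).2 fun t ht ↦ ?_
    have hmem : ∑ j, t j • σ j (w s₀) ∈ C (w s₀) := by
      rw [← (hspan _ hx₀).2]
      exact Submodule.sum_mem _ fun j _ ↦ Submodule.smul_mem _ _
        (Submodule.subset_span (Set.mem_range_self j))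
    have h₀ := hf _ _ hmem fun i ↦ by
      have h := congr_fun ht i
      rw [hΨ_apply s₀ he.self_of_nhds] at h
      exact ((e i).linearEquivAt ℝ _ (he.self_of_nhds i)).map_eq_zero_iff.1 h
    exact funext (Fintype.linearIndependent_iff.1 (hspan _ hx₀).1 t h₀)
  have hy : ContMDiffAt I 𝓘(ℝ, ι → W.F) ∞ (fun s i ↦ (e i ((f i).total ⟨w s, c s⟩)).2) s₀ :=
    contMDiffAt_pi_space.2 fun i ↦ (contMDiffAt_totalSpace.1 (hfc i s₀)).2
  obtain ⟨τ, hτ, hτs⟩ := hΨ.exists_solution hinj hy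
  refine contMDiffAt_totalSpace.2 ⟨hw.contMDiffAt, ?_⟩
  have hsum : ContMDiffAt I 𝓘(ℝ, V.F) ∞
      (fun s ↦ ∑ j, τ s j • (e₀ ⟨w s, σ j (w s)⟩).2) s₀ :=
    contMDiffAt_finsetSum fun j _ ↦ (contMDiffAt_pi_space.1 hτ j).smul
      (contMDiffAt_totalSpace.1 (hσw j)).2
  refine hsum.congr_of_eventuallyEq ?_
  filter_upwards [hτs, he₀, he, hwU] with s h₁ h₂ h₃ h₄
  obtain ⟨t, ht⟩ : ∃ t : Fin r → ℝ, ∑ j, t j • σ j (w s) = c s := by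
    have h := hcC s
    rw [← (hspan _ h₄).2] at h
    exact (Submodule.mem_span_range_iff_exists_fun ℝ).1 h
  have h₅ : t = τ s := h₁ t (funext fun i ↦ by rw [hΨ_apply s h₃, ht])
  change e₀.linearEquivAt ℝ _ h₂ (c s) = ∑ j, τ s j • e₀.linearEquivAt ℝ _ h₂ (σ j (w s))
  rw [← ht, h₅, map_sum]
  simp only [map_smul]

end VectorBundleSmoothness

/-! ### Faces, kernels and fillers in simplicial vector bundles. -/

/-- This form covers both orders of the two faces at once, which lets their roles be exchanged
later. -/
theorem SimplexCategory.δ_comp_δ_predAbove {n : ℕ} (i : Fin (n + 3)) (j : Fin (n + 2)) :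
    SimplexCategory.δ j ≫ SimplexCategory.δ i =
      SimplexCategory.δ (j.predAbove i) ≫ SimplexCategory.δ (i.succAbove j) := by
  ext x : 3
  exact (Fin.succAbove_succAbove_succAbove_predAbove i j x).symm

namespace VB

variable {V W : VB.{u}}

/-- A zero vector of a total space is determined by its base point. -/
theorem total_ext_of_snd_eq_zero {v w : V.Total} (h : v.proj = w.proj) (hv : v.snd = 0)
    (hw : w.snd = 0) : v = w := by
  obtain ⟨x, v⟩ := v
  obtain ⟨y, w⟩ := w
  obtain rfl : x = y := h
  obtain rfl : v = 0 := hv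
  obtain rfl : w = 0 := hw
  rfl

theorem Hom.total_snd_eq_zero (f : Hom V W) {v : V.Total} (hv : v.snd = 0) :
    (f.total v).snd = 0 := by
  change f.fiberMap v.proj v.snd = 0
  rw [hv, map_zero]

end VB

namespace SimplicialVB

variable (V : SimplicialVB.{u})

/-- The face map `d_i : V_{n+1} → V_n`. -/
abbrev d (n : ℕ) (i : Fin (n + 2)) : VB.Hom (V _⦋n + 1⦌) (V _⦋n⦌) :=
  V.map (SimplexCategory.δ i).op

/-- Total spaces are used because the two iterated faces lie in fibers over base points that are not
definitionally equal. -/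
theorem d_total_d_total {n : ℕ} (i : Fin (n + 3)) (j : Fin (n + 2)) (v : (V _⦋n + 2⦌).Total) :
    (V.d n j).total ((V.d (n + 1) i).total v) =
      (V.d n (j.predAbove i)).total ((V.d (n + 1) (i.succAbove j)).total v) := by
  have h : V.map (SimplexCategory.δ i).op ≫ V.map (SimplexCategory.δ j).op =
      V.map (SimplexCategory.δ (i.succAbove j)).op ≫
        V.map (SimplexCategory.δ (j.predAbove i)).op := by
    rw [← V.map_comp, ← V.map_comp, ← op_comp, ← op_comp, SimplexCategory.δ_comp_δ_predAbove]
  exact congr_arg (fun f ↦ VB.Hom.total f v) h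

/-- Every simplex of the horn factors through a face other than the `k`-th. -/
theorem mem_hornKernel_iff {n : ℕ} {k : Fin (n + 2)} {g : (V _⦋n + 1⦌).base}
    {v : (V _⦋n + 1⦌).fiber g} :
    v ∈ V.hornKernel (n + 1) k g ↔ ∀ j ≠ k, (V.d n j).fiberMap g v = 0 := by
  simp only [hornKernel, Submodule.mem_iInf]
  refine ⟨fun h j hj ↦ h n _ ((SSet.objEquiv_symm_δ_mem_horn_iff j k).2 hj), fun h m θ hθ ↦ ?_⟩
  obtain ⟨j, hj, hjθ⟩ := (SSet.mem_horn_iff_notMem_range _ _).1 hθ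
  obtain ⟨θ', rfl⟩ := SimplexCategory.eq_comp_δ_of_not_surjective' θ j fun x hx ↦ hjθ ⟨x, hx⟩
  have h₁ : (VB.Hom.total (V.map (SimplexCategory.δ j).op ≫ V.map θ'.op) ⟨g, v⟩).snd = 0 :=
    VB.Hom.total_snd_eq_zero (V.map θ'.op) (v := (V.d n j).total ⟨g, v⟩) (h j hj)
  rw [← V.map_comp] at h₁
  exact h₁

theorem mem_faceKernel_iff {n : ℕ} {k : Fin (n + 2)} {g : (V _⦋n + 1⦌).base}
    {v : (V _⦋n + 1⦌).fiber g} (hv : v ∈ V.hornKernel (n + 1) k g) :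
    v ∈ V.faceKernel n g ↔ (V.d n k).fiberMap g v = 0 := by
  simp only [faceKernel, Submodule.mem_iInf]
  refine ⟨fun h ↦ h k, fun h j ↦ ?_⟩
  by_cases hj : j = k
  · exact hj ▸ h
  · exact V.mem_hornKernel_iff.1 hv j hj

theorem total_δ_comp_yonedaEquiv_symm {n : ℕ} (x : (V _⦋n + 1⦌).Total) (j : Fin (n + 2)) :
    SSet.stdSimplex.δ j ≫ (SSet.yonedaEquiv (X := V.total)).symm x =
      (SSet.yonedaEquiv (X := V.total)).symm ((V.d n j).total x) :=
  SSet.stdSimplex.δ_comp_yonedaEquiv_symm (X := V.total) x j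

theorem yonedaEquiv_symm_comp_projection {n : ℕ} (x : (V _⦋n⦌).Total) :
    (SSet.yonedaEquiv (X := V.total)).symm x ≫ V.projection =
      (SSet.yonedaEquiv (X := simplicialSetOf V.baseManifold)).symm
        (show (V _⦋n⦌).base from x.proj) :=
  SSet.yonedaEquiv_symm_comp (X := V.total) x V.projection

variable {V}

open SSet.modelCategoryQuillen in
/-- Horns of vectors over a simplex of the base, all of whose faces but one vanish, can be
filled. -/
theorem IsVectorFibration.exists_filler (hV : V.IsVectorFibration) {n : ℕ} (b : Fin (n + 3))
    (a' : Fin (n + 2)) (w : (V _⦋n + 2⦌).base)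
    (v : (V _⦋n + 1⦌).fiber (V.face (n + 1) b w)) (hv : v ∈ V.hornKernel (n + 1) a' _) :
    ∃ x : (V _⦋n + 2⦌).fiber w, (V.d (n + 1) b).fiberMap w x = v ∧
      ∀ i, i ≠ b.succAbove a' → i ≠ b → (V.d (n + 1) i).fiberMap w x = 0 := by
  classical
  let F (j : Fin (n + 3)) : (V _⦋n + 1⦌).Total :=
    if j = b then ⟨V.face (n + 1) b w, v⟩ else ⟨V.face (n + 1) j w, 0⟩
  have hFb : F b = ⟨V.face (n + 1) b w, v⟩ := if_pos rfl
  have hF (j) (hj : j ≠ b) : F j = ⟨V.face (n + 1) j w, 0⟩ := if_neg hj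
  have hproj (j) : (F j).proj = V.face (n + 1) j w := by
    by_cases hj : j = b
    · subst hj; rw [hFb]
    · rw [hF j hj]
  -- All codimension-two faces shared by two faces of the horn are zero, on face `b` because `v`
  -- lies in a horn kernel. Compatibility thus only concerns base points.
  have hzero (j i) (hij : j.succAbove i ≠ b.succAbove a') : ((V.d n i).total (F j)).snd = 0 := by
    by_cases hj : j = b
    · subst hj
      rw [hFb]
      exact V.mem_hornKernel_iff.1 hv i fun h ↦ hij (h ▸ rfl)
    · rw [hF j hj]
      exact map_zero _
  have : HomotopicalAlgebra.Fibration V.projection := by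
    refine (SSet.modelCategoryQuillen.fibration_iff _).2 fun _ _ i hi ↦ ?_
    simp only [SSet.modelCategoryQuillen.J, MorphismProperty.iSup_iff] at hi
    obtain ⟨m, ⟨j⟩⟩ := hi
    exact hV.kan _ j
  have hcomp : SSet.horn.IsCompatible (i := b.succAbove a')
      (fun j _ ↦ (SSet.yonedaEquiv (X := V.total)).symm (F j)) := by
    refine (SSet.horn.isCompatible_iff _).2 fun j k hj hk hjk ↦ ?_
    refine (V.total_δ_comp_yonedaEquiv_symm _ _).trans
      (Eq.trans ?_ (V.total_δ_comp_yonedaEquiv_symm _ _).symm)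
    refine congr_arg _ ?_
    refine VB.total_ext_of_snd_eq_zero ?_ (hzero _ _ ?_) (hzero _ _ ?_)
    · have h := congr_arg TotalSpace.proj
        (V.d_total_d_total j (k.pred (Fin.ne_zero_of_lt hjk)) ⟨w, 0⟩)
      rw [Fin.predAbove_pred_of_lt _ _ hjk, Fin.succAbove_pred_of_lt _ _ hjk] at h
      change V.face n _ (F j).proj = V.face n _ (F k).proj
      rw [hproj, hproj]
      exact h
    · rwa [Fin.succAbove_pred_of_lt _ _ hjk]
    · rwa [Fin.succAbove_castPred_of_lt _ _ hjk]
  obtain ⟨φ, hφ, hφp⟩ := hcomp.exists_lift V.projection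
    ((SSet.yonedaEquiv (X := simplicialSetOf V.baseManifold)).symm w) fun j hj ↦ by
      refine Eq.trans ?_
        (simplicialSetOf.δ_comp_yonedaEquiv_symm V.baseManifold (n := n + 1) w j).symm
      refine (V.yonedaEquiv_symm_comp_projection _).trans (congr_arg _ (hproj j))
  obtain ⟨x, rfl⟩ : ∃ x : (V _⦋n + 2⦌).Total, φ = (SSet.yonedaEquiv (X := V.total)).symm x :=
    ⟨_, ((SSet.yonedaEquiv (X := V.total)).symm_apply_apply φ).symm⟩
  have hxw : x.proj = w := (SSet.yonedaEquiv (X := simplicialSetOf V.baseManifold)).symm.injective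
    ((V.yonedaEquiv_symm_comp_projection x).symm.trans hφp)
  have hxF (j) (hj : j ≠ b.succAbove a') : (V.d (n + 1) j).total x = F j :=
    (SSet.yonedaEquiv (X := V.total)).symm.injective
      ((V.total_δ_comp_yonedaEquiv_symm x j).symm.trans (hφ j hj))
  obtain ⟨_, x⟩ := x
  obtain rfl : _ = w := hxw
  refine ⟨x, ?_, fun i hi hib ↦ ?_⟩
  · exact TotalSpace.mk_injective _ ((hxF b (Fin.succAbove_ne b a').symm).trans hFb)
  · exact TotalSpace.mk_injective _ ((hxF i hi).trans (hF i hib))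

end SimplicialVB

/-! ### Transport of horn kernels and the trivialization. -/

namespace SimplicialVB

variable {V : SimplicialVB.{u}}

/-- A vector in a complement of a horn kernel is determined by its horn. -/
theorem eq_zero_of_mem_of_disjoint {n : ℕ} {k : Fin (n + 2)} {g : (V _⦋n + 1⦌).base}
    {C : Submodule ℝ ((V _⦋n + 1⦌).fiber g)} (hC : Disjoint C (V.hornKernel (n + 1) k g))
    {c : (V _⦋n + 1⦌).fiber g} (hc : c ∈ C) (h : ∀ i ≠ k, (V.d n i).fiberMap g c = 0) : c = 0 :=
  Submodule.disjoint_def.1 hC c hc (V.mem_hornKernel_iff.2 h)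

/-- Injectivity is `C ∩ K = 0`; surjectivity takes the `C`-component of a filler, since the
`K`-component does not affect the faces in the horn. `P` enters through its membership condition, so
that the same `P` serves with the two faces exchanged. -/
theorem IsVectorFibration.exists_linearEquiv_hornKernel (hV : V.IsVectorFibration) {n : ℕ}
    (b : Fin (n + 3)) (a' : Fin (n + 2)) (w : (V _⦋n + 2⦌).base)
    {C P : Submodule ℝ ((V _⦋n + 2⦌).fiber w)}
    (hC : IsCompl C (V.hornKernel (n + 2) (b.succAbove a') w))
    (hP : ∀ c, c ∈ P ↔ c ∈ C ∧
      ∀ i, i ≠ b.succAbove a' → i ≠ b → (V.d (n + 1) i).fiberMap w c = 0) :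
    ∃ e : P ≃ₗ[ℝ] V.hornKernel (n + 1) a' (V.face (n + 1) b w),
      ∀ c : P, (e c : (V _⦋n + 1⦌).fiber (V.face (n + 1) b w)) =
        (V.d (n + 1) b).fiberMap w c := by
  have hmem (c : P) : (V.d (n + 1) b).fiberMap w c ∈
      V.hornKernel (n + 1) a' (V.face (n + 1) b w) := by
    refine V.mem_hornKernel_iff.2 fun j hj ↦ ?_
    have h : ((V.d n j).total ((V.d (n + 1) b).total ⟨w, c⟩)).snd = 0 := by
      rw [V.d_total_d_total b j ⟨w, c⟩]
      exact VB.Hom.total_snd_eq_zero (V.d n _) (v := (V.d (n + 1) _).total ⟨w, c⟩)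
        (((hP c).1 c.2).2 _ (fun h ↦ hj (Fin.succAbove_right_injective h))
          (Fin.succAbove_ne b j))
    exact h
  let f : P →ₗ[ℝ] V.hornKernel (n + 1) a' (V.face (n + 1) b w) :=
    (((V.d (n + 1) b).fiberMap w).comp P.subtype).codRestrict _ hmem
  have hf : Function.Bijective f := by
    refine ⟨(injective_iff_map_eq_zero f).2 fun c hc ↦ Subtype.ext ?_, fun v ↦ ?_⟩
    · refine eq_zero_of_mem_of_disjoint hC.disjoint ((hP c).1 c.2).1 fun i hi ↦ ?_
      by_cases hib : i = b
      · subst hib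
        exact congr_arg Subtype.val hc
      · exact ((hP c).1 c.2).2 i hi hib
    · obtain ⟨x, hxb, hx⟩ := hV.exists_filler b a' w v v.2
      obtain ⟨c, hc, κ, hκ, rfl⟩ := Submodule.mem_sup.1
        (hC.codisjoint.eq_top.symm ▸ Submodule.mem_top : x ∈ C ⊔ _)
      have hd (i) (hi : i ≠ b.succAbove a') : (V.d (n + 1) i).fiberMap w (c + κ) =
          (V.d (n + 1) i).fiberMap w c := by
        rw [map_add, V.mem_hornKernel_iff.1 hκ i hi, add_zero]
      exact ⟨⟨c, (hP c).2 ⟨hc, fun i hi hib ↦ (hd i hi).symm.trans (hx i hi hib)⟩⟩,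
        Subtype.ext ((hd b (Fin.succAbove_ne b a').symm).symm.trans hxb)⟩
  exact ⟨LinearEquiv.ofBijective f hf, fun c ↦ rfl⟩

/-- Face kernels over two faces of a simplex of the base correspond to each other. -/
theorem mem_faceKernel_iff_of_faces {n : ℕ} (b : Fin (n + 3)) (a' : Fin (n + 2))
    {w : (V _⦋n + 2⦌).base} {c : (V _⦋n + 2⦌).fiber w}
    (ha : (V.d (n + 1) (b.succAbove a')).fiberMap w c ∈
      V.hornKernel (n + 1) (a'.predAbove b) (V.face (n + 1) (b.succAbove a') w))
    (hb : (V.d (n + 1) b).fiberMap w c ∈ V.hornKernel (n + 1) a' (V.face (n + 1) b w)) :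
    (V.d (n + 1) b).fiberMap w c ∈ V.faceKernel n (V.face (n + 1) b w) ↔
      (V.d (n + 1) (b.succAbove a')).fiberMap w c ∈
        V.faceKernel n (V.face (n + 1) (b.succAbove a') w) := by
  -- Each membership is the vanishing of one further face, and these iterated faces agree by the
  -- simplicial identity.
  refine (V.mem_faceKernel_iff hb).trans (Iff.trans ?_ (V.mem_faceKernel_iff ha).symm)
  change ((V.d n _).total ((V.d (n + 1) b).total ⟨w, c⟩)).snd = 0 ↔
    ((V.d n _).total ((V.d (n + 1) _).total ⟨w, c⟩)).snd = 0
  rw [V.d_total_d_total b a' ⟨w, c⟩]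

/-- The vectors of a common complement of two horn kernels identify horn kernels over two faces of
a simplex of the base. -/
theorem IsVectorFibration.exists_transport (hV : V.IsVectorFibration) {n : ℕ}
    (b : Fin (n + 3)) (a' : Fin (n + 2)) (w : (V _⦋n + 2⦌).base)
    {C : Submodule ℝ ((V _⦋n + 2⦌).fiber w)}
    (ha : IsCompl C (V.hornKernel (n + 2) (b.succAbove a') w))
    (hb : IsCompl C (V.hornKernel (n + 2) b w)) {g : (V _⦋n + 1⦌).base}
    (hg : V.face (n + 1) (b.succAbove a') w = g) :
    ∃ T : V.hornKernel (n + 1) (a'.predAbove b) g ≃ₗ[ℝ]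
        V.hornKernel (n + 1) a' (V.face (n + 1) b w),
      ∀ y : V.hornKernel (n + 1) (a'.predAbove b) g,
        ((T y : (V _⦋n + 1⦌).fiber (V.face (n + 1) b w)) ∈ V.faceKernel n (V.face (n + 1) b w) ↔
          (y : (V _⦋n + 1⦌).fiber g) ∈ V.faceKernel n g) ∧
        ∃ c ∈ C, (∀ i, i ≠ b.succAbove a' → i ≠ b → (V.d (n + 1) i).fiberMap w c = 0) ∧
          (V.d (n + 1) (b.succAbove a')).total ⟨w, c⟩ = ⟨g, y⟩ ∧
          (V.d (n + 1) b).total ⟨w, c⟩ = ⟨V.face (n + 1) b w, T y⟩ := by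
  subst hg
  let P : Submodule ℝ ((V _⦋n + 2⦌).fiber w) := C ⊓ ⨅ (i) (_ : i ≠ b.succAbove a') (_ : i ≠ b),
    V.ker (SimplexCategory.δ i) w
  have hP (c) : c ∈ P ↔ c ∈ C ∧
      ∀ i, i ≠ b.succAbove a' → i ≠ b → (V.d (n + 1) i).fiberMap w c = 0 := by
    simp only [P, Submodule.mem_inf, Submodule.mem_iInf]
    rfl
  -- This identity exchanges the roles of the two faces.
  have hab : (b.succAbove a').succAbove (a'.predAbove b) = b :=
    Fin.succAbove_succAbove_predAbove b a'
  obtain ⟨e, he⟩ := hV.exists_linearEquiv_hornKernel b a' w ha hP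
  obtain ⟨e', he'⟩ := hV.exists_linearEquiv_hornKernel (b.succAbove a') (a'.predAbove b) w
    (C := C) (P := P) (by rwa [hab]) fun c ↦ by
      rw [hP, hab]
      exact and_congr_right fun _ ↦ forall_congr' fun i ↦ forall_comm
  refine ⟨e'.symm.trans e, fun y ↦ ?_⟩
  obtain ⟨c, rfl⟩ := e'.surjective y
  rw [LinearEquiv.trans_apply, e'.symm_apply_apply]
  refine ⟨?_, c, ((hP c).1 c.2).1, ((hP c).1 c.2).2, congr_arg (TotalSpace.mk _) (he' c).symm,
    congr_arg (TotalSpace.mk _) (he c).symm⟩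
  have ha' := (e' c).2
  have hb' := (e c).2
  rw [he] at hb' ⊢
  rw [he'] at ha' ⊢
  exact mem_faceKernel_iff_of_faces b a' ha' hb'

section Smooth

variable {ES HS S : Type*} [NormedAddCommGroup ES] [NormedSpace ℝ ES] [TopologicalSpace HS]
  {I : ModelWithCorners ℝ ES HS} [TopologicalSpace S] [ChartedSpace HS S]

/-- A family of vectors in a complement of a horn kernel is smooth if its faces are. -/
theorem contMDiff_of_d {n : ℕ} (k : Fin (n + 2))
    {C : ∀ g, Submodule ℝ ((V _⦋n + 1⦌).fiber g)} (hC : (V _⦋n + 1⦌).IsSubbundle C)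
    (hk : ∀ g, IsCompl (C g) (V.hornKernel (n + 1) k g)) {w : S → (V _⦋n + 1⦌).base}
    (hw : ContMDiff I 𝓘(ℝ, (V _⦋n + 1⦌).base.E) ∞ w) (c : ∀ s, (V _⦋n + 1⦌).fiber (w s))
    (hcC : ∀ s, c s ∈ C (w s))
    (hc : ∀ i ≠ k, ContMDiff I (V _⦋n⦌).model ∞ fun s ↦ (V.d n i).total ⟨w s, c s⟩) :
    ContMDiff I (V _⦋n + 1⦌).model ∞ fun s ↦ (⟨w s, c s⟩ : (V _⦋n + 1⦌).Total) :=
  hC.contMDiff (fun i : {i // i ≠ k} ↦ V.d n i)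
    (fun x _ hv h ↦ eq_zero_of_mem_of_disjoint (hk x).disjoint hv fun i hi ↦ h ⟨i, hi⟩) hw c hcC
    fun i ↦ hc i i.2

theorem contMDiff_d_total_of_eq_zero {n : ℕ} (i : Fin (n + 2)) {w : S → (V _⦋n + 1⦌).base}
    (hw : ContMDiff I 𝓘(ℝ, (V _⦋n + 1⦌).base.E) ∞ w) (c : ∀ s, (V _⦋n + 1⦌).fiber (w s))
    (hc : ∀ s, (V.d n i).fiberMap (w s) (c s) = 0) :
    ContMDiff I (V _⦋n⦌).model ∞ fun s ↦ (V.d n i).total ⟨w s, c s⟩ := by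
  have h : ContMDiff I (V _⦋n⦌).model ∞
      fun s ↦ zeroSection (V _⦋n⦌).F (V _⦋n⦌).fiber ((V.d n i).base.toFun (w s)) :=
    (contMDiff_zeroSection ℝ (V _⦋n⦌).fiber).comp ((V.d n i).base.smooth.comp hw)
  exact h.congr fun s ↦ congr_arg (TotalSpace.mk _) (hc s)

end Smooth

/-- If a smooth family of simplices of the base has a constant face, then the horn kernel along
another face is trivial, through the vectors of a common complement of two horn kernels. -/
theorem IsVectorFibration.exists_trivialization (hV : V.IsVectorFibration) {n : ℕ}
    (b : Fin (n + 3)) (a' : Fin (n + 2)) {C : ∀ g, Submodule ℝ ((V _⦋n + 2⦌).fiber g)}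
    (hC : (V _⦋n + 2⦌).IsSubbundle C)
    (ha : ∀ g, IsCompl (C g) (V.hornKernel (n + 2) (b.succAbove a') g))
    (hb : ∀ g, IsCompl (C g) (V.hornKernel (n + 2) b g)) {Z : Mfd.{u}}
    {w : Z → (V _⦋n + 2⦌).base} (hw : Mfd.IsSmooth w) {g : (V _⦋n + 1⦌).base}
    (hg : ∀ z, V.face (n + 1) (b.succAbove a') (w z) = g) :
    ∃ τ : (V _⦋n + 1⦌).Trivialization (V.hornKernel (n + 1) a') fun z ↦ V.face (n + 1) b (w z),
      τ.Preserves (V.faceKernel n) := by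
  classical
  have := VB.finiteDimensional_fiber (V _⦋n + 1⦌) g
  let β : EuclideanSpace ℝ (Fin (Module.finrank ℝ (V.hornKernel (n + 1) (a'.predAbove b) g))) ≃ₗ[ℝ]
      V.hornKernel (n + 1) (a'.predAbove b) g :=
    LinearEquiv.ofFinrankEq _ _ finrank_euclideanSpace_fin
  choose T hT using fun z ↦ hV.exists_transport b a' (w z) (ha _) (hb _) (hg z)
  choose c hcC hc hca hcb using fun z y ↦ (hT z y).2
  -- The model subspace is the face kernel over the constant face, read through `β`; transport
  -- preserves it for every `z`.
  refine ⟨⟨_, fun z ↦ β.trans (T z), ?_, fun S f v hf hv ↦ ?_⟩,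
    (V.faceKernel n g).comap ((Submodule.subtype _).comp β.toLinearMap),
    fun z y ↦ (hT z (β y)).1⟩
  -- The faces of `c` other than the `b`-th are smooth: one is a linear family in a fixed fiber, the
  -- others vanish. So `c` is smooth, and with it its `b`-th face.
  · have h := contMDiff_of_d b hC hb (ContMDiff.comp hw contMDiff_fst)
      (fun p : Z × EuclideanSpace ℝ _ ↦ c p.1 (β p.2)) (fun p ↦ hcC _ _) fun i hi ↦ by
        by_cases hia : i = b.succAbove a'
        · subst hia
          exact (((V _⦋n + 1⦌).contMDiff_mk_fiber g
            ((Submodule.subtype _).comp β.toLinearMap)).comp contMDiff_snd).congr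
              fun p ↦ hca p.1 (β p.2)
        · exact contMDiff_d_total_of_eq_zero i (ContMDiff.comp hw contMDiff_fst) _
            fun p ↦ hc _ _ i hia hi
    exact ((V.d (n + 1) b).contMDiff_total.comp h).congr fun p ↦ (hcb p.1 (β p.2)).symm
  -- For the inverse the known nonzero face is the `b`-th, and the face in the fixed fiber is read
  -- off.
  · have h := contMDiff_of_d (b.succAbove a') hC ha (ContMDiff.comp hw hf)
      (fun s ↦ c (f s) ((T (f s)).symm (v s))) (fun s ↦ hcC _ _) fun i hi ↦ by
        by_cases hib : i = b
        · subst hib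
          refine hv.congr fun s ↦ (hcb _ _).trans ?_
          rw [LinearEquiv.apply_symm_apply]
        · exact contMDiff_d_total_of_eq_zero i (ContMDiff.comp hw hf) _
            fun p ↦ hc _ _ i hi hib
    -- `β.symm` is defined on a subspace only; an extension to the whole fiber can be applied to
    -- smooth families.
    obtain ⟨L, hL⟩ := LinearMap.exists_extend β.symm.toLinearMap
    exact (VB.contMDiff_of_mk_fiber g L
      (((V.d (n + 1) _).contMDiff_total.comp h).congr fun s ↦ (hca _ _).symm)).congr
        fun s ↦ (LinearMap.congr_fun hL ((T (f s)).symm (v s))).symm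

/-- Degeneracies of a family of simplices with a constant face provide simplices along which the
horn kernel can be trivialized. -/
theorem IsVectorFibration.exists_trivialization_of_degeneracy (hV : V.IsVectorFibration) {n : ℕ}
    {b : Fin (n + 3)} {a' : Fin (n + 2)} {j : Fin (n + 2)} {j' : Fin (n + 1)}
    (hjb : V.σ j ≫ V.δ b = 𝟙 _) (hja : V.σ j ≫ V.δ (b.succAbove a') = V.δ a' ≫ V.σ j')
    {C : ∀ g, Submodule ℝ ((V _⦋n + 2⦌).fiber g)} (hC : (V _⦋n + 2⦌).IsSubbundle C)
    (ha : ∀ g, IsCompl (C g) (V.hornKernel (n + 2) (b.succAbove a') g))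
    (hb : ∀ g, IsCompl (C g) (V.hornKernel (n + 2) b g)) {Z : Mfd.{u}}
    {ι : Z → (V _⦋n + 1⦌).base} (hι : Mfd.IsSmooth ι) {g : (V _⦋n⦌).base}
    (hg : ∀ z, V.face n a' (ι z) = g) :
    ∃ τ : (V _⦋n + 1⦌).Trivialization (V.hornKernel (n + 1) a') ι,
      τ.Preserves (V.faceKernel n) := by
  have h : (fun z ↦ V.face (n + 1) b (Mfd.Hom.toFun (VB.Hom.base (V.σ j)) (ι z))) = ι :=
    funext fun z ↦ congr_arg (fun f ↦ Mfd.Hom.toFun (VB.Hom.base f) (ι z)) hjb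
  have key := hV.exists_trivialization b a' hC ha hb (Z := Z)
    (w := fun z ↦ Mfd.Hom.toFun (VB.Hom.base (V.σ j)) (ι z))
    (ContMDiff.comp (Mfd.Hom.smooth (VB.Hom.base (V.σ j))) hι)
    (g := Mfd.Hom.toFun (VB.Hom.base (V.σ j')) g) fun z ↦
      (congr_arg (fun f ↦ Mfd.Hom.toFun (VB.Hom.base f) (ι z)) hja).trans
        (congr_arg (Mfd.Hom.toFun (VB.Hom.base (V.σ j'))) (hg z))
  rwa [h] at key

end SimplicialVB

/-! ### The choice of degeneracy. -/

theorem mainTheorem6 (V : SimplicialVB.{u}) (hV : V.IsVectorFibration) (n : ℕ)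
    (k : Fin (n + 2)) (l : Fin (n + 3)) (hkl : k.castSucc < l)
    (C : ∀ g : (V _⦋n + 2⦌).base, Submodule ℝ ((V _⦋n + 2⦌).fiber g))
    (hC : (V _⦋n + 2⦌).IsSubbundle C)
    (hk : ∀ g, IsCompl (C g) (V.hornKernel (n + 2) k.castSucc g))
    (hl : ∀ g, IsCompl (C g) (V.hornKernel (n + 2) l g)) :
    Mfd.IsSubmersion (V.face n k) ∧
    ∀ (g : (V _⦋n⦌).base) (Z : Mfd.{u}) (ι : Z → (V _⦋n + 1⦌).base),
      Mfd.IsEmbedding ι → Set.range ι = V.face n k ⁻¹' {g} →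
        ∃ τ : (V _⦋n + 1⦌).Trivialization (V.hornKernel (n + 1) k) ι,
          τ.Preserves (V.faceKernel n) := by
  refine ⟨hV.base.isSubmersion_δ n k, fun g Z ι hι hZ ↦ ?_⟩
  have hg (z) : V.face n k (ι z) = g := by
    have h : ι z ∈ V.face n k ⁻¹' {g} := hZ ▸ Set.mem_range_self z
    exact h
  have hιs : Mfd.IsSmooth ι := Manifold.IsSmoothEmbedding.contMDiff hι
  -- If `k` is last, then `l = k + 1` and no degeneracy has `z` as its `l`-th face and a degeneracy
  -- of `d_k z` as its `k`-th. Here face `k` is `z` and face `l` is constant; otherwise face `l` is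
  -- `z` and face `k` is constant.
  by_cases hlast : k = Fin.last (n + 1)
  · subst hlast
    obtain rfl : l = (Fin.last (n + 1)).succ :=
      Fin.last_le_iff.1 (Fin.castSucc_lt_iff_succ_le.1 hkl)
    have h := Fin.succAbove_castSucc_self (Fin.last (n + 1))
    refine hV.exists_trivialization_of_degeneracy (b := (Fin.last (n + 1)).castSucc)
      (j := (Fin.last n).castSucc) (j' := Fin.last n)
      (V.δ_comp_σ_succ (i := (Fin.last n).castSucc)) ?_ hC ?_ hk hιs hg
    · rw [h]
      exact V.δ_comp_σ_of_gt (Fin.castSucc_lt_last _)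
    · rwa [h]
  · have h : l.succAbove k = k.castSucc := Fin.succAbove_of_castSucc_lt _ _ hkl
    -- The degeneracy `s_{j+1}` has `z` as its `l`-th face for `j = l - 2` or `j = l - 1`; the
    -- condition `k ≤ j` forces the latter when `l = k + 1`.
    obtain ⟨j, hkj, hjl⟩ : ∃ j : Fin (n + 1), k ≤ j.castSucc ∧
        (l = j.succ.castSucc ∨ l = j.succ.succ) := by
      have h₁ : k.val < n + 1 := Fin.val_lt_last hlast
      have h₂ : k.val < l.val := hkl
      by_cases hl2 : k.val + 2 ≤ l.val
      · exact ⟨⟨l.val - 2, by omega⟩, Nat.le_sub_of_add_le hl2,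
          .inr (Fin.ext (Nat.sub_add_cancel (by omega : 2 ≤ l.val)).symm)⟩
      · exact ⟨⟨k.val, h₁⟩, le_rfl, .inl (Fin.ext (by omega : l.val = k.val + 1))⟩
    refine hV.exists_trivialization_of_degeneracy (b := l) (j := j.succ) (j' := j) ?_ ?_ hC ?_ hl
      hιs hg
    · rcases hjl with rfl | rfl
      · exact V.δ_comp_σ_self
      · exact V.δ_comp_σ_succ
    · rw [h]
      exact V.δ_comp_σ_of_le hkj
    · rwa [h]
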